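/- Throughout, $\log^+t:=\max\{1,\log t\}$ (with $\log^+ 0:=1$), $\mu$ is the Gaussian measure $d\mu(x)=(2\pi)^{-n/2}e^{-|x|^2/2}\,dx$ on $\mathbb R^n$, and $\mathrm{div}_\mu f(x)=\mathrm{div} f(x)-x\cdot f(x)$ for a differentiable vector field $f$ on $\mathbb R^n$. For an increasing homeomorphism $P$ of $[0,\infty)$, the Orlicz space $L^P(\mu)$ is the set of measurable $f$ with $\|f\|_{L^P(\mu)}:=\inf\{\lambda>0:\int_{\mathbb R^n} P(|f|/\lambda)\,d\mu\le 1\}<\infty$. The space $\mathrm{Exp}_\mu(\frac{L}{\log L})$ is the one with $P(t)=\exp\{t/\log^+t\}-1$, and $L^{\Phi_\alpha}(\mu)$ is the one with $P(t)=\Phi_\alpha(t)=t\exp\{(\log^+t)^\alpha\}$, $\alpha>0$. **Theorem 1.2.** Let $T>0$ and let $b:[0,T]\times\mathbb R^n\to\mathbb R^n$ be a Borel vector field such that 1. $b(t,\cdot)\in C^2(\mathbb R^n)$ for each $t\in[0,T]$, and for every $R>0$ there is $\ell_R\in L^1(0,T)$ with $\|D_xb(t,x)\|\le \ell_R(t)$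 for all $t\in[0,T]$ and $|x|\le R$; 2. $\dfrac{|b(t,x)|}{1+|x|\log^+|x|}\in L^1(0,T;L^\infty(\mathbb R^n))$; 3. $\mathrm{div}_\mu b\in L^1\big(0,T;\mathrm{Exp}_\mu(\tfrac{L}{\log L})\big)$, that is, $\beta(r):=\|\mathrm{div}_\mu b(r,\cdot)\|_{\mathrm{Exp}_\mu(\frac{L}{\log L})}$ satisfies $\int_0^T\beta(r)\,dr<\infty$. Then there is a unique flow $X(s,t,x)$, $0\le s\le t\le T$, $x\in\mathbb R^n$, with $$\frac{\partial X(s,t,x)}{\partial t}=b(t,X(s,t,x)),\qquad X(s,s,x)=x,$$ in the sense that, for every $s$ and every $x$, $t\mapsto b(t,X(s,t,x))$ belongs to $L^1(s,T)$ and $X(s,t,x)=x+\int_s^tb(r,X(s,r,x))\,dr$ for all $t\in[s,T]$; moreover $X$ is Borel. For all $0\le s\le t\le T$ the image measure $X(s,t,\cdot)_\#\mu$ is absolutely continuous with respect to $\mu$, and for every $\alpha$ with $$0<\alpha<\exp\Big\{-16e\int_s^t\beta(r)\,dr\Big\}$$ its density $K_{s,t}=\frac{d}{d\mu}\big(X(s,t,\cdot)_\#\mu\big)$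 belongs to $L^{\Phi_\alpha}(\mu)$ and satisfies $$\int_{\mathbb R^n}\Phi_\alpha(K_{s,t}(x))\,d\mu(x)\le C(\alpha,s,t,\mathrm{div}_\mu b),$$ where, for given $n$ and $T$, the finite constant $C$ depends on $b$ only through the function $\mathrm{div}_\mu b$ on $[0,T]\times\mathbb R^n$. -/

import Mathlib

open MeasureTheory Set
open scoped ENNReal NNReal

namespace SubexpFlow

/-- The space `ℝⁿ`, with the Euclidean norm. -/
abbrev E (n : ℕ) := EuclideanSpace ℝ (Fin n)

/-- `log⁺ t = max {1, log t}`. (This is not Mathlib's `Real.posLog`, which truncates at `0`.) -/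
noncomputable def logPlus (t : ℝ) : ℝ := max 1 (Real.log t)

/-- The Orlicz function `exp (t / log⁺ t) - 1` of the space `Exp (L / log L)`. -/
noncomputable def expLLog (t : ℝ) : ℝ := Real.exp (t / logPlus t) - 1

/-- The Orlicz function `Φ_α (t) = t exp ((log⁺ t) ^ α)`. -/
noncomputable def PhiFun (α t : ℝ) : ℝ := t * Real.exp (logPlus t ^ α)

/-- The Luxemburg functional `inf {l > 0 : ∫ P (|f| / l) dμ ≤ 1}`, with value `∞` if there is
no such `l`. -/
noncomputable def luxNorm {Ω : Type*} [MeasurableSpace Ω] (P : ℝ → ℝ) (μ : Measure Ω)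
    (f : Ω → ℝ) : ℝ≥0∞ :=
  sInf {c : ℝ≥0∞ | ∃ l : ℝ, 0 < l ∧ c = ENNReal.ofReal l ∧
    ∫⁻ x, ENNReal.ofReal (P (|f x| / l)) ∂μ ≤ 1}

/-- Membership in the Orlicz space `L^P (μ)`. -/
def MemOrlicz {Ω : Type*} [MeasurableSpace Ω] (P : ℝ → ℝ) (μ : Measure Ω) (f : Ω → ℝ) : Prop :=
  AEStronglyMeasurable f μ ∧ luxNorm P μ f < ∞

/-- The Gaussian measure `(2π)^(-n/2) exp (-|x|²/2) dx`. -/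
noncomputable def gauss (n : ℕ) : Measure (E n) :=
  volume.withDensity fun x =>
    ENNReal.ofReal ((2 * Real.pi) ^ (-(n : ℝ) / 2) * Real.exp (-‖x‖ ^ 2 / 2))

/-- The divergence `∑ᵢ ∂ᵢ fᵢ` of a differentiable vector field. -/
noncomputable def divergence {n : ℕ} (f : E n → E n) (x : E n) : ℝ :=
  ∑ i : Fin n, (fderiv ℝ f x (EuclideanSpace.single i 1)) i

/-- The Gaussian divergence `div_μ f (x) = div f (x) - x · f (x)`. -/
noncomputable def divGauss {n : ℕ} (f : E n → E n) (x : E n) : ℝ :=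
  divergence f x - inner ℝ x (f x)

/-- `β (r)`, the norm of `div_μ b (r, ·)` in `Exp_μ (L / log L)`. -/
noncomputable def beta {n : ℕ} (b : ℝ → E n → E n) (r : ℝ) : ℝ≥0∞ :=
  luxNorm expLLog (gauss n) (divGauss (b r))

/-- The hypotheses on the vector field `b` on `[0, T] × ℝⁿ`; values of `b` at times outside
`[0, T]` play no role. -/
structure Admissible {n : ℕ} (T : ℝ) (b : ℝ → E n → E n) : Prop where
  /-- `b` is Borel. -/
  measurable : Measurable fun p : ℝ × E n => b p.1 p.2
  /-- `b (t, ·)` is of class `C²` for each `t`. -/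
  contDiff : ∀ t ∈ Icc 0 T, ContDiff ℝ 2 (b t)
  /-- The Carathéodory condition: on each ball the spatial derivative of `b` is dominated by an
  integrable function of time. -/
  locLipschitz : ∀ R : ℝ, ∃ ℓ : ℝ → ℝ, IntegrableOn ℓ (Icc 0 T) ∧
    ∀ t ∈ Icc 0 T, ∀ x : E n, ‖x‖ ≤ R → ‖fderiv ℝ (b t) x‖ ≤ ℓ t
  /-- `|b (t, x)| / (1 + |x| log⁺ |x|)` belongs to `L¹(0, T; L^∞)`. -/
  growth : ∫⁻ t in Icc 0 T,
    eLpNorm (fun x : E n => ‖b t x‖ / (1 + ‖x‖ * logPlus ‖x‖)) ∞ volume < ∞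
  /-- `div_μ b` belongs to `L¹(0, T; Exp_μ (L / log L))`. -/
  divergence : ∫⁻ t in Icc 0 T, beta b t < ∞

/-- `X` is a (forward, everywhere defined) flow of `b`: for all `s` and all `x` the curve
`t ↦ X (s, t, x)` on `[s, T]` is a Carathéodory solution of `y' = b (t, y)`, `y (s) = x`, that is,
an absolutely continuous one; this is the integral equation below. -/
def IsFlow {n : ℕ} (T : ℝ) (b : ℝ → E n → E n) (X : ℝ → ℝ → E n → E n) : Prop :=
  ∀ s ∈ Icc 0 T, ∀ x : E n,
    IntegrableOn (fun r => b r (X s r x)) (Icc s T) ∧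
    ∀ t ∈ Icc s T, X s t x = x + ∫ r in s..t, b r (X s r x)

/-- The density `K_{s,t}` of the image `X(s, t, ·)_# μ` with respect to `μ`. -/
noncomputable def density {n : ℕ} (X : ℝ → ℝ → E n → E n) (s t : ℝ) (x : E n) : ℝ :=
  (((gauss n).map (X s t)).rnDeriv (gauss n) x).toReal

end SubexpFlow

namespace SubexpFlow

open Filter Topology

/-! ### Absolutely continuous curves -/

/-! The flow itself is classical. A field growing like `|x| log |x|` cannot blow up, since `log (1 +
log (1 + |x|²))` grows along trajectories at a rate bounded by three times the growth rate of the
field. Hence truncating the field outside a large ball does not change a given trajectory, and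
Picard iteration for the truncated, globally Lipschitz field produces it. The flow maps are
injective and differentiable, and Liouville's formula together with the evolution of `|X|²` gives
the Jacobian relative to `μ` as `exp I`, where `I(t, x)` is the integral of `div_μ b` along the
trajectory from time `s` to time `t` (`RegularField.exists_hasFDerivAt_det`). So `∫ exp (I) F(X) dμ
≤ ∫ F dμ` for `F ≥ 0`, the image measure has a density `K` with `K(X) = exp (-I)`, and `∫ Φ_α(K) dμ
= ∫ exp ((log⁺ exp (-I))^α) dμ`.

The heart of the matter is to bound the last integral. Put `M = (1 + I²)^(1/2)` and `a(t) = exp (-16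
∫_s^t B)`, with `B` slightly larger than `β`; for `α ≤ a` the integrand is at most `exp (M^a)`.
Along a trajectory, with `d` the divergence and `w = |d| / B`, the time derivative of `exp (M^a)`
has the sign of `-16 B log M + I d / M²`. If `w ≤ 16 M log M`, this is nonpositive: the decay of the
exponent `a` pays for the growth of `M`. If `w > 16 M log M`, then `exp (M^a) ≤ exp (I) exp (2M)`,
and `w exp (2M)` is at most a constant times `exp (w / log⁺ w)` (`mul_exp_le_of_lt`). In both cases
the derivative is at most `exp (I) · const · B exp (w / log⁺ w)` (`fderiv_expPotential_le`). The
factor `exp (I)` is the Jacobian, so integrating in `x` moves the right-hand side from the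
trajectories back to the fixed measure `μ`, where the Orlicz bound on `div_μ b` applies
(`RegularField.lintegral_expPotential_le`). No prior information on the density and no closing
Grönwall argument is needed. -/

theorem absolutelyContinuousOnInterval_of_dist_le {X Y : Type*} [PseudoMetricSpace X]
    [PseudoMetricSpace Y] {f : ℝ → X} {g : ℝ → Y} {a b K : ℝ}
    (hg : AbsolutelyContinuousOnInterval g a b)
    (h : ∀ x ∈ uIcc a b, ∀ y ∈ uIcc a b, dist (f x) (f y) ≤ K * dist (g x) (g y)) :
    AbsolutelyContinuousOnInterval f a b := by
  unfold AbsolutelyContinuousOnInterval at hg ⊢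
  have hg' := hg.const_mul K
  rw [mul_zero] at hg'
  refine squeeze_zero' (Eventually.of_forall fun E => Finset.sum_nonneg fun _ _ => dist_nonneg)
    ?_ hg'
  have : ∀ᶠ E : ℕ × (ℕ → ℝ × ℝ) in AbsolutelyContinuousOnInterval.totalLengthFilter ⊓
      𝓟 (AbsolutelyContinuousOnInterval.disjWithin a b),
      E ∈ AbsolutelyContinuousOnInterval.disjWithin a b :=
    eventually_inf_principal.mpr (by simp)
  filter_upwards [this] with E hE
  rw [Finset.mul_sum]
  exact Finset.sum_le_sum fun i hi => h _ (hE.1 i hi).1 _ (hE.1 i hi).2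

/-- The chain rule, in integral form, for a `C¹` function along an absolutely continuous curve. -/
theorem integral_fderiv_comp {V : Type*} [NormedAddCommGroup V] [NormedSpace ℝ V]
    [FiniteDimensional ℝ V] {φ : V → ℝ} (hφ : ContDiff ℝ 1 φ) {u v : ℝ → V} {a b : ℝ}
    (hab : a ≤ b) (hv : IntervalIntegrable v volume a b)
    (hu : ∀ t ∈ Icc a b, u t = u a + ∫ r in a..t, v r) :
    IntervalIntegrable (fun r => fderiv ℝ φ (u r) (v r)) volume a b ∧
      φ (u b) - φ (u a) = ∫ r in a..b, fderiv ℝ φ (u r) (v r) := by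
  have : CompleteSpace V := FiniteDimensional.complete ℝ V
  -- The curve `u` is controlled only on `[a, b]`. Its extension `w` is defined everywhere and has a
  -- two-sided derivative at almost every point of the interval.
  set w : ℝ → V := fun t => u a + ∫ r in a..t, v r with hw
  have hwc : ContinuousOn w (uIcc a b) :=
    continuousOn_const.add (intervalIntegral.continuousOn_primitive_interval'
      hv left_mem_uIcc)
  obtain ⟨R, hR⟩ := (isCompact_uIcc.image_of_continuousOn hwc).isBounded.subset_closedBall 0
  -- On a ball containing the compact image of `w`, `φ` is Lipschitz, so the increments of `φ ∘ w`
  -- are dominated by those of `∫ ‖v‖`; this gives absolute continuity.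
  obtain ⟨K, hK⟩ := hφ.contDiffOn.exists_lipschitzOnWith (s := Metric.closedBall (0 : V) R)
    (by decide) (convex_closedBall _ _) (isCompact_closedBall _ _)
  have hsub : ∀ x ∈ uIcc a b, ∀ y ∈ uIcc a b, IntervalIntegrable v volume x y := fun x hx y hy =>
    hv.mono_set (uIcc_subset_uIcc hx hy)
  have hAC : AbsolutelyContinuousOnInterval (fun t => φ (w t)) a b := by
    refine absolutelyContinuousOnInterval_of_dist_le (K := K)
      (hv.norm.absolutelyContinuousOnInterval_intervalIntegral (c := a) left_mem_uIcc) ?_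
    intro x hx y hy
    have h1 := hK.dist_le_mul _ (hR (mem_image_of_mem _ hx)) _ (hR (mem_image_of_mem _ hy))
    refine h1.trans (mul_le_mul_of_nonneg_left ?_ K.2)
    have e1 : w x - w y = ∫ r in y..x, v r := by
      simp only [hw]
      rw [← intervalIntegral.integral_interval_sub_left (hsub _ left_mem_uIcc _ hx)
        (hsub _ left_mem_uIcc _ hy)]
      abel
    rw [dist_eq_norm, e1, Real.dist_eq, intervalIntegral.integral_interval_sub_left
      (hsub _ left_mem_uIcc _ hx).norm (hsub _ left_mem_uIcc _ hy).norm]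
    exact intervalIntegral.norm_integral_le_abs_integral_norm
  have hder : ∀ᵐ r, r ∈ uIoc a b → deriv (fun t => φ (w t)) r = fderiv ℝ φ (u r) (v r) := by
    filter_upwards [hv.ae_hasDerivAt_integral] with r hr hr'
    have hr2 : r ∈ uIcc a b := uIoc_subset_uIcc hr'
    have h1 : HasDerivAt w (v r) r := (hr hr2 a left_mem_uIcc).const_add _
    have h2 := ((hφ.differentiable one_ne_zero (w r)).hasFDerivAt.comp_hasDerivAt r h1).deriv
    have h3 : w r = u r := by rw [hu r (by rwa [uIcc_of_le hab] at hr2)]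
    rw [h3] at h2
    exact h2
  have hb : w b = u b := (hu b ⟨hab, le_rfl⟩).symm
  have ha : w a = u a := by simp [hw]
  refine ⟨?_, ?_⟩
  · refine hAC.intervalIntegrable_deriv.congr_ae ?_
    rwa [EventuallyEq, ae_restrict_iff' measurableSet_uIoc]
  · rw [← hb, ← ha, ← hAC.integral_deriv_eq_sub]
    exact intervalIntegral.integral_congr_ae hder

/-- Chain rule for `exp (c x)` along a primitive of `ℓ`. With `c = 2` it says that integration
against `ℓ` gains a factor `1/2` on the weight `exp (2 ∫ ℓ)`; both the Grönwall bound and the Picard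
iteration rest on this gain. -/
theorem integral_mul_exp_primitive {ℓ : ℝ → ℝ} {a b : ℝ} (hab : a ≤ b) (c : ℝ)
    (hℓ : IntervalIntegrable ℓ volume a b) :
    IntervalIntegrable (fun r => ℓ r * Real.exp (c * ∫ q in a..r, ℓ q)) volume a b ∧
    c * ∫ r in a..b, ℓ r * Real.exp (c * ∫ q in a..r, ℓ q) =
      Real.exp (c * ∫ q in a..b, ℓ q) - 1 := by
  have hcont : ContinuousOn (fun r => Real.exp (c * ∫ q in a..r, ℓ q)) (uIcc a b) :=
    Real.continuous_exp.comp_continuousOn (continuousOn_const.mul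
      (intervalIntegral.continuousOn_primitive_interval' hℓ left_mem_uIcc))
  refine ⟨hℓ.mul_continuousOn hcont, ?_⟩
  have h := (integral_fderiv_comp (φ := fun x : ℝ => Real.exp (c * x)) (by fun_prop)
    (u := fun t => ∫ q in a..t, ℓ q) (v := ℓ) hab hℓ (by simp)).2
  simp only [intervalIntegral.integral_same, mul_zero, Real.exp_zero] at h
  rw [h, ← intervalIntegral.integral_const_mul]
  refine intervalIntegral.integral_congr fun r _ => ?_
  have : HasDerivAt (fun x : ℝ => Real.exp (c * x)) (Real.exp (c * ∫ q in a..r, ℓ q) * c)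
      (∫ q in a..r, ℓ q) := by
    have := ((hasDerivAt_id (∫ q in a..r, ℓ q)).const_mul c).exp
    simpa using this
  simp only [this.hasFDerivAt.fderiv, ContinuousLinearMap.toSpanSingleton_apply, smul_eq_mul]
  ring

/-- A weak form of Grönwall's inequality for an integrable rate. -/
theorem gronwall_weak {ℓ u : ℝ → ℝ} {s T A : ℝ} (hA : 0 ≤ A)
    (hℓ : IntervalIntegrable ℓ volume s T) (hℓ0 : ∀ r, 0 ≤ ℓ r)
    (hu : ContinuousOn u (Icc s T))
    (h : ∀ t ∈ Icc s T, u t ≤ A + ∫ r in s..t, ℓ r * u r) :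
    ∀ t ∈ Icc s T, u t ≤ 2 * A * Real.exp (2 * ∫ r in s..t, ℓ r) := by
  intro t₀ ht₀
  have hsT : s ≤ T := ht₀.1.trans ht₀.2
  set Λ : ℝ → ℝ := fun t => ∫ r in s..t, ℓ r with hΛ
  have hΛc : ContinuousOn Λ (Icc s T) := by
    rw [← uIcc_of_le hsT]
    exact intervalIntegral.continuousOn_primitive_interval' hℓ left_mem_uIcc
  have hc : ContinuousOn (fun t => u t * Real.exp (-(2 * Λ t))) (Icc s T) := by fun_prop
  -- At a maximum point `m` of the weighted function, with maximum `S > 0`, the hypothesis reads `S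
  -- e^(2Λ(m)) ≤ A + S (e^(2Λ(m)) - 1) / 2`, which forces `S ≤ 2A`.
  obtain ⟨m, hm, hmax⟩ := isCompact_Icc.exists_isMaxOn (nonempty_Icc.2 hsT) hc
  set S := u m * Real.exp (-(2 * Λ m)) with hS
  have hle : ∀ r ∈ Icc s T, u r ≤ S * Real.exp (2 * Λ r) := by
    intro r hr
    have h1 : u r * Real.exp (-(2 * Λ r)) ≤ S := hmax hr
    rw [Real.exp_neg] at h1
    exact (mul_inv_le_iff₀ (Real.exp_pos _)).1 h1
  rcases le_or_gt S 0 with hS0 | hS0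
  · refine (hle _ ht₀).trans ((mul_nonpos_of_nonpos_of_nonneg hS0 (Real.exp_pos _).le).trans ?_)
    positivity
  have key : S ≤ 2 * A := by
    have h1 := h m hm
    have hℓm : IntervalIntegrable ℓ volume s m :=
      hℓ.mono_set (by rw [uIcc_of_le hm.1, uIcc_of_le hsT]; exact Icc_subset_Icc_right hm.2)
    obtain ⟨hI, hE⟩ := integral_mul_exp_primitive hm.1 2 hℓm
    have h2 : ∫ r in s..m, ℓ r * u r ≤ ∫ r in s..m, S * (ℓ r * Real.exp (2 * Λ r)) := by
      refine intervalIntegral.integral_mono_on hm.1 (hℓm.mul_continuousOn ?_) (hI.const_mul S) ?_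
      · rw [uIcc_of_le hm.1]; exact hu.mono (Icc_subset_Icc_right hm.2)
      · intro r hr
        have := mul_le_mul_of_nonneg_left (hle r ⟨hr.1, hr.2.trans hm.2⟩) (hℓ0 r)
        linarith
    rw [intervalIntegral.integral_const_mul] at h2
    have h3 : u m = S * Real.exp (2 * Λ m) := by
      rw [hS, mul_assoc, ← Real.exp_add]; simp
    have hpos : 0 ≤ Λ m := intervalIntegral.integral_nonneg hm.1 fun r _ => hℓ0 r
    have h4 : 1 ≤ Real.exp (2 * Λ m) := Real.one_le_exp (by positivity)
    change 2 * (∫ r in s..m, ℓ r * Real.exp (2 * Λ r)) = Real.exp (2 * Λ m) - 1 at hE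
    nlinarith
  exact (hle _ ht₀).trans (mul_le_mul_of_nonneg_right key (Real.exp_pos _).le)

/-! ### Picard iteration -/

section Picard

variable {V : Type*} [NormedAddCommGroup V] [NormedSpace ℝ V] [FiniteDimensional ℝ V]
  [MeasurableSpace V] [BorelSpace V]

theorem measurable_setIntegral_Ioc {α : Type*} [MeasurableSpace α] {F : α → ℝ → V} {a b : α → ℝ}
    (hF : Measurable (Function.uncurry F)) (ha : Measurable a) (hb : Measurable b) :
    Measurable fun p => ∫ r in Ioc (a p) (b p), F p r := by
  have : ProperSpace V := FiniteDimensional.proper ℝ V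
  have h1 : Measurable (Function.uncurry fun (p : α) (r : ℝ) =>
      (Ioc (a p) (b p)).indicator (fun r => F p r) r) := by
    have : (Function.uncurry fun (p : α) (r : ℝ) =>
        (Ioc (a p) (b p)).indicator (fun r => F p r) r) =
        {q : α × ℝ | a q.1 < q.2 ∧ q.2 ≤ b q.1}.indicator (Function.uncurry F) := by
      ext q
      simp only [Function.uncurry, indicator, mem_Ioc, mem_ofPred_eq]
      congr
    rw [this]
    exact hF.indicator ((measurableSet_lt (ha.comp measurable_fst) measurable_snd).inter
      (measurableSet_le measurable_snd (hb.comp measurable_fst)))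
  have h2 := (StronglyMeasurable.integral_prod_right (ν := (volume : Measure ℝ))
    h1.stronglyMeasurable).measurable
  convert h2 using 1
  ext p
  exact (integral_indicator measurableSet_Ioc).symm

/-- The Picard iterates of `y' = f (t, y)`, `y (s) = x`. -/
noncomputable def picard (f : ℝ → V → V) : ℕ → ℝ → ℝ → V → V
  | 0, _, _, x => x
  | k + 1, s, t, x => x + ∫ r in Ioc s t, f r (picard f k s r x)

theorem measurable_picard {f : ℝ → V → V} (hf : Measurable (Function.uncurry f)) (k : ℕ) :
    Measurable fun p : ℝ × ℝ × V => picard f k p.1 p.2.1 p.2.2 := by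
  have : ProperSpace V := FiniteDimensional.proper ℝ V
  induction k with
  | zero => exact measurable_snd.snd
  | succ k ih =>
    simp only [picard]
    refine measurable_snd.snd.add ?_
    refine measurable_setIntegral_Ioc (F := fun (p : ℝ × ℝ × V) r => f r (picard f k p.1 r p.2.2))
      ?_ measurable_fst measurable_snd.fst
    exact hf.comp (measurable_snd.prodMk (ih.comp
      (measurable_fst.fst.prodMk (measurable_snd.prodMk measurable_fst.snd.snd))))

variable {f : ℝ → V → V} {ℓ : ℝ → ℝ}

theorem integrable_comp_of_lipschitz (hf : Measurable (Function.uncurry f)) (hℓ : Integrable ℓ)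
    (hL : ∀ t x y, ‖f t x - f t y‖ ≤ ℓ t * ‖x - y‖) (hℓ0 : ∀ r, 0 ≤ ℓ r)
    {x : V} (hi : Integrable fun r => f r x) {y : ℝ → V}
    (hy : Measurable y) {S : Set ℝ} (hS : MeasurableSet S) {B : ℝ}
    (hB : ∀ r ∈ S, ‖y r - x‖ ≤ B) :
    IntegrableOn (fun r => f r (y r)) S := by
  have : ProperSpace V := FiniteDimensional.proper ℝ V
  refine Integrable.mono' (g := fun r => ‖f r x‖ + ℓ r * B)
    (hi.norm.add (hℓ.mul_const B)).integrableOn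
    (hf.comp (measurable_id.prodMk hy)).aestronglyMeasurable ?_
  refine (ae_restrict_iff' hS).2 (Eventually.of_forall fun r hr => ?_)
  have h1 := hL r (y r) x
  have h2 := norm_le_norm_add_norm_sub' (f r (y r)) (f r x)
  have h3 := mul_le_mul_of_nonneg_left (hB r hr) (hℓ0 r)
  linarith

theorem integrableOn_picard (hf : Measurable (Function.uncurry f)) (hℓ : Integrable ℓ)
    (hℓ0 : ∀ r, 0 ≤ ℓ r) (hL : ∀ t x y, ‖f t x - f t y‖ ≤ ℓ t * ‖x - y‖)
    (s : ℝ) {x : V} (hi : Integrable fun r => f r x) (k : ℕ) :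
    IntegrableOn (fun r => f r (picard f k s r x)) (Ioi s) := by
  have hm : ∀ k, Measurable fun r => picard f k s r x := fun k =>
    (measurable_picard hf k).comp
      (measurable_const.prodMk (measurable_id.prodMk measurable_const))
  induction k with
  | zero =>
    exact hi.integrableOn
  | succ k ih =>
    refine integrable_comp_of_lipschitz hf hℓ hL hℓ0 hi (hm _) measurableSet_Ioi
      (B := ∫ r in Ioi s, ‖f r (picard f k s r x)‖) fun t _ => ?_
    simp only [picard, add_sub_cancel_left]
    refine (norm_integral_le_integral_norm _).trans ?_
    exact setIntegral_mono_set ih.norm (Eventually.of_forall fun _ => norm_nonneg _)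
      Ioc_subset_Ioi_self.eventuallyLE

/-- In the norm weighted by `exp (-2 ∫ ℓ)` each Picard step contracts by `1/2`, whatever the size of
`∫ ℓ`; hence the solution is global without gluing short time intervals. -/
theorem norm_picard_succ_sub_le (hf : Measurable (Function.uncurry f)) (hℓ : Integrable ℓ)
    (hℓ0 : ∀ r, 0 ≤ ℓ r) (hL : ∀ t x y, ‖f t x - f t y‖ ≤ ℓ t * ‖x - y‖)
    (s : ℝ) {x : V} (hi : Integrable fun r => f r x) (k : ℕ) {t : ℝ} (ht : s ≤ t) :
    ‖picard f (k + 1) s t x - picard f k s t x‖ ≤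
      (∫ r, ‖f r x‖) * (1 / 2) ^ k * Real.exp (2 * ∫ r in s..t, ℓ r) := by
  have hM : 0 ≤ ∫ r, ‖f r x‖ := integral_nonneg fun _ => norm_nonneg _
  induction k generalizing t with
  | zero =>
    simp only [picard, add_sub_cancel_left, pow_zero, mul_one]
    have h1 : ‖∫ r in Ioc s t, f r x‖ ≤ ∫ r, ‖f r x‖ :=
      (norm_integral_le_integral_norm _).trans
        (setIntegral_le_integral hi.norm (Eventually.of_forall fun _ => norm_nonneg _))
    have h2 : 0 ≤ ∫ r in s..t, ℓ r := intervalIntegral.integral_nonneg ht fun r _ => hℓ0 r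
    have h3 : 1 ≤ Real.exp (2 * ∫ r in s..t, ℓ r) := Real.one_le_exp (by positivity)
    nlinarith
  | succ k ih =>
    set c := (∫ r, ‖f r x‖) * (1 / 2) ^ k with hc
    have hc0 : 0 ≤ c := by positivity
    obtain ⟨hI, hE⟩ := integral_mul_exp_primitive ht 2 hℓ.intervalIntegrable
    have e : picard f (k + 1 + 1) s t x - picard f (k + 1) s t x =
        ∫ r in Ioc s t, (f r (picard f (k + 1) s r x) - f r (picard f k s r x)) := by
      rw [integral_sub ((integrableOn_picard hf hℓ hℓ0 hL s hi _).mono_set Ioc_subset_Ioi_self)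
        ((integrableOn_picard hf hℓ hℓ0 hL s hi _).mono_set Ioc_subset_Ioi_self)]
      simp only [picard]
      abel
    rw [e]
    have h1 : ‖∫ r in Ioc s t, (f r (picard f (k + 1) s r x) - f r (picard f k s r x))‖ ≤
        ∫ r in Ioc s t, c * (ℓ r * Real.exp (2 * ∫ q in s..r, ℓ q)) := by
      refine norm_integral_le_of_norm_le
        (((intervalIntegrable_iff_integrableOn_Ioc_of_le ht).1 hI).const_mul c) ?_
      refine (ae_restrict_iff' measurableSet_Ioc).2 (Eventually.of_forall fun r hr => ?_)
      refine (hL _ _ _).trans ?_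
      have := mul_le_mul_of_nonneg_left (ih hr.1.le) (hℓ0 r)
      linarith
    rw [integral_const_mul,
      ← intervalIntegral.integral_of_le (f := fun r => ℓ r * Real.exp _) ht] at h1
    rw [pow_succ, ← mul_assoc, ← hc]
    nlinarith

/-- Global existence for `y' = f (t, y)`, where `f` is Lipschitz in space with an integrable
Lipschitz constant; the solution depends measurably on all its arguments. -/
theorem exists_solution_of_lipschitz (hf : Measurable (Function.uncurry f)) (hℓ : Integrable ℓ)
    (hℓ0 : ∀ r, 0 ≤ ℓ r) (hL : ∀ t x y, ‖f t x - f t y‖ ≤ ℓ t * ‖x - y‖)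
    (hi : ∀ x, Integrable fun r => f r x) :
    ∃ X : ℝ → ℝ → V → V, Measurable (fun p : ℝ × ℝ × V => X p.1 p.2.1 p.2.2) ∧
      ∀ s x, IntegrableOn (fun r => f r (X s r x)) (Ioi s) ∧
        ∀ t, s ≤ t → X s t x = x + ∫ r in s..t, f r (X s r x) := by
  have : ProperSpace V := FiniteDimensional.proper ℝ V
  set C : V → ℝ := fun x => 2 * ((∫ r, ‖f r x‖) * Real.exp (2 * ∫ r, ℓ r)) with hC
  have hbound : ∀ s t x k, dist (picard f k s t x) (picard f (k + 1) s t x) ≤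
      C x / 2 / 2 ^ k := by
    intro s t x k
    have hM : 0 ≤ ∫ r, ‖f r x‖ := integral_nonneg fun _ => norm_nonneg _
    rcases le_or_gt s t with h | h
    · rw [dist_comm, dist_eq_norm]
      refine (norm_picard_succ_sub_le hf hℓ hℓ0 hL s (hi x) k h).trans ?_
      have h1 : Real.exp (2 * ∫ r in s..t, ℓ r) ≤ Real.exp (2 * ∫ r, ℓ r) := by
        rw [intervalIntegral.integral_of_le h]
        have := setIntegral_le_integral (s := Ioc s t) hℓ (Eventually.of_forall hℓ0)
        gcongr
      have h2 : C x / 2 / 2 ^ k = (∫ r, ‖f r x‖) * (1 / 2) ^ k * Real.exp (2 * ∫ r, ℓ r) := by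
        simp only [hC, one_div, inv_pow]; field_simp
      rw [h2]
      gcongr
    -- For `t < s` the interval `Ioc s t` is empty and the iterates are constant, so the limit
    -- exists for all `(s, t, x)` and is jointly measurable.
    · have : ∀ k, picard f k s t x = x := by
        intro k
        cases k with
        | zero => rfl
        | succ k => simp [picard, Ioc_eq_empty_of_le h.le]
      rw [this, this, dist_self]
      positivity
  have hlim : ∀ s t x, ∃ y, Tendsto (fun k => picard f k s t x) atTop (𝓝 y) := fun s t x =>
    cauchySeq_tendsto_of_complete (cauchySeq_of_le_geometric_two (hbound s t x))
  choose X hX using hlim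
  have hdist : ∀ s t x k, dist (picard f k s t x) (X s t x) ≤ C x / 2 ^ k := fun s t x k =>
    dist_le_of_le_geometric_two_of_tendsto (hbound s t x) (hX s t x) k
  have hXm : Measurable (fun p : ℝ × ℝ × V => X p.1 p.2.1 p.2.2) :=
    measurable_of_tendsto_metrizable (measurable_picard hf)
      (tendsto_pi_nhds.2 fun p => hX p.1 p.2.1 p.2.2)
  refine ⟨X, hXm, fun s x => ?_⟩
  have hint : IntegrableOn (fun r => f r (X s r x)) (Ioi s) := by
    refine integrable_comp_of_lipschitz hf hℓ hL hℓ0 (hi x) (hXm.comp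
      (measurable_const.prodMk (measurable_id.prodMk measurable_const))) measurableSet_Ioi
      (B := C x) fun t _ => ?_
    have := hdist s t x 0
    simpa [picard, dist_eq_norm, norm_sub_rev] using this
  refine ⟨hint, fun t ht => ?_⟩
  rw [intervalIntegral.integral_of_le ht]
  have h1 : Tendsto (fun k => picard f (k + 1) s t x) atTop (𝓝 (X s t x)) :=
    (hX s t x).comp (tendsto_add_atTop_nat 1)
  refine tendsto_nhds_unique h1 ?_
  simp only [picard]
  refine tendsto_const_nhds.add ?_
  refine tendsto_integral_of_dominated_convergence
    (fun r => ‖f r (X s r x)‖ + ℓ r * C x) (fun k => ?_) ?_ (fun k => ?_) ?_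
  · exact ((integrableOn_picard hf hℓ hℓ0 hL s (hi x) k).mono_set
      Ioc_subset_Ioi_self).aestronglyMeasurable
  · exact (hint.mono_set Ioc_subset_Ioi_self).norm.add (hℓ.mul_const _).integrableOn
  · refine Eventually.of_forall fun r => ?_
    have h2 := hdist s r x k
    have h3 : C x / 2 ^ k ≤ C x := by
      have hC0 : 0 ≤ C x := by
        have hM : 0 ≤ ∫ r, ‖f r x‖ := integral_nonneg fun _ => norm_nonneg _
        positivity
      exact div_le_self hC0 (one_le_pow₀ (by norm_num))
    rw [dist_eq_norm] at h2
    have h4 := hL r (picard f k s r x) (X s r x)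
    have h5 := mul_le_mul_of_nonneg_left (h2.trans h3) (hℓ0 r)
    have h6 := norm_le_norm_add_norm_sub' (f r (picard f k s r x)) (f r (X s r x))
    linarith
  · refine Eventually.of_forall fun r => ?_
    rw [tendsto_iff_norm_sub_tendsto_zero]
    have h2 := (tendsto_iff_norm_sub_tendsto_zero.1 (hX s r x)).const_mul (ℓ r)
    rw [mul_zero] at h2
    exact squeeze_zero (fun _ => norm_nonneg _) (fun k => hL _ _ _) h2

end Picard

/-! ### Calculus of absolutely continuous curves. -/

/-- `u` is an absolutely continuous curve on `[a, b]` with derivative `v`. -/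
structure IsPrimitive {V : Type*} [NormedAddCommGroup V] [NormedSpace ℝ V]
    (u v : ℝ → V) (a b : ℝ) : Prop where
  le : a ≤ b
  integrable : IntervalIntegrable v volume a b
  eq : ∀ t ∈ Icc a b, u t = u a + ∫ r in a..t, v r

namespace IsPrimitive

variable {V W : Type*} [NormedAddCommGroup V] [NormedSpace ℝ V] [NormedAddCommGroup W]
  [NormedSpace ℝ W] {u v u' v' : ℝ → V} {a b : ℝ}

theorem mono (h : IsPrimitive u v a b) {c : ℝ} (hc : c ∈ Icc a b) : IsPrimitive u v a c :=
  ⟨hc.1, h.integrable.mono_set (by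
    rw [uIcc_of_le hc.1, uIcc_of_le h.le]; exact Icc_subset_Icc_right hc.2),
    fun t ht => h.eq t ⟨ht.1, ht.2.trans hc.2⟩⟩

theorem sub (h : IsPrimitive u v a b) (h' : IsPrimitive u' v' a b) :
    IsPrimitive (fun t => u t - u' t) (fun r => v r - v' r) a b :=
  ⟨h.le, h.integrable.sub h'.integrable, fun t ht => by
    rw [h.eq t ht, h'.eq t ht, intervalIntegral.integral_sub (h.mono ht).integrable
      (h'.mono ht).integrable]; abel⟩

theorem prodMk [CompleteSpace V] [CompleteSpace W] {y z : ℝ → W} (h : IsPrimitive u v a b)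
    (h' : IsPrimitive y z a b) :
    IsPrimitive (fun t => (u t, y t)) (fun r => (v r, z r)) a b := by
  refine ⟨h.le, ?_, fun t ht => ?_⟩
  · have h1 := h.integrable
    have h2 := h'.integrable
    rw [intervalIntegrable_iff_integrableOn_Ioc_of_le h.le] at h1 h2 ⊢
    exact h1.prodMk h2
  · have h1 := (h.mono ht).integrable
    have h2 := (h'.mono ht).integrable
    rw [intervalIntegrable_iff_integrableOn_Ioc_of_le ht.1] at h1 h2
    rw [h.eq t ht, h'.eq t ht, intervalIntegral.integral_of_le ht.1,
      intervalIntegral.integral_of_le ht.1, intervalIntegral.integral_of_le ht.1,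
      integral_pair h1 h2]
    simp

theorem primitive (hab : a ≤ b) (hv : IntervalIntegrable v volume a b) :
    IsPrimitive (fun t => ∫ r in a..t, v r) v a b :=
  ⟨hab, hv, by simp⟩

theorem comp [FiniteDimensional ℝ V] {φ : V → ℝ} (h : IsPrimitive u v a b)
    (hφ : ContDiff ℝ 1 φ) :
    IsPrimitive (fun t => φ (u t)) (fun r => fderiv ℝ φ (u r) (v r)) a b :=
  ⟨h.le, (integral_fderiv_comp hφ h.le h.integrable h.eq).1, fun t ht => by
    rw [← (integral_fderiv_comp hφ ht.1 (h.mono ht).integrable (h.mono ht).eq).2]; ring⟩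

theorem continuousOn (h : IsPrimitive u v a b) : ContinuousOn u (Icc a b) := by
  have : ContinuousOn (fun t => u a + ∫ r in a..t, v r) (Icc a b) := by
    rw [← uIcc_of_le h.le]
    exact continuousOn_const.add
      (intervalIntegral.continuousOn_primitive_interval' h.integrable left_mem_uIcc)
  exact this.congr h.eq

theorem congr_deriv (h : IsPrimitive u v a b) (hv : ∀ r ∈ Icc a b, v r = v' r) :
    IsPrimitive u v' a b := by
  refine ⟨h.le, (intervalIntegrable_congr ?_).1 h.integrable, fun t ht => ?_⟩
  · intro r hr
    rw [uIoc_of_le h.le] at hr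
    exact hv r (Ioc_subset_Icc_self hr)
  · rw [h.eq t ht]
    congr 1
    refine intervalIntegral.integral_congr fun r hr => ?_
    rw [uIcc_of_le ht.1] at hr
    exact hv r ⟨hr.1, hr.2.trans ht.2⟩

theorem le_add_integral {u v w : ℝ → ℝ} (h : IsPrimitive u v a b)
    (hw : IntervalIntegrable w volume a b) (hvw : ∀ r ∈ Icc a b, v r ≤ w r) :
    u b ≤ u a + ∫ r in a..b, w r := by
  rw [h.eq b ⟨h.le, le_rfl⟩]
  have := intervalIntegral.integral_mono_on h.le h.integrable hw hvw
  linarith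

theorem le_of_deriv_nonpos {u v : ℝ → ℝ} (h : IsPrimitive u v a b)
    (hv : ∀ r ∈ Icc a b, v r ≤ 0) : u b ≤ u a := by
  simpa using h.le_add_integral (w := fun _ => 0) intervalIntegrable_const hv

theorem le_of_deriv_nonneg {u v : ℝ → ℝ} (h : IsPrimitive u v a b)
    (hv : ∀ r ∈ Icc a b, 0 ≤ v r) : u a ≤ u b := by
  rw [h.eq b ⟨h.le, le_rfl⟩]
  linarith [intervalIntegral.integral_nonneg (μ := volume) h.le hv]

end IsPrimitive

/-! ### Carathéodory solutions -/

theorem logPlus_mono {x y : ℝ} (hx : 0 ≤ x) (hxy : x ≤ y) : logPlus x ≤ logPlus y := by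
  unfold logPlus
  rcases hx.eq_or_lt with rfl | hx
  · simp
  · exact max_le_max_left _ (Real.log_le_log hx hxy)

theorem one_le_logPlus (x : ℝ) : 1 ≤ logPlus x := le_max_left _ _

theorem measurable_logPlus : Measurable logPlus :=
  measurable_const.max Real.measurable_log

/-- `y` is a Carathéodory solution on `[s, T]` of `y' = f (t, y)`, `y (s) = x`. -/
def IsSol {n : ℕ} (f : ℝ → E n → E n) (s T : ℝ) (x : E n) (y : ℝ → E n) : Prop :=
  IntegrableOn (fun r => f r (y r)) (Icc s T) ∧
    ∀ t ∈ Icc s T, y t = x + ∫ r in s..t, f r (y r)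

section Solutions

variable {n : ℕ} {f : ℝ → E n → E n} {s T : ℝ} {x x' : E n} {y z : ℝ → E n}

theorem IsSol.init (h : IsSol f s T x y) (hsT : s ≤ T) : y s = x := by
  simpa using h.2 s ⟨le_rfl, hsT⟩

theorem IsSol.isPrimitive (h : IsSol f s T x y) (hsT : s ≤ T) :
    IsPrimitive y (fun r => f r (y r)) s T :=
  ⟨hsT, (intervalIntegrable_iff_integrableOn_Icc_of_le hsT).2 h.1,
    fun t ht => by rw [h.init hsT]; exact h.2 t ht⟩

theorem IsSol.mono (h : IsSol f s T x y) {t : ℝ} (ht : t ≤ T) : IsSol f s t x y :=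
  ⟨h.1.mono_set (Icc_subset_Icc_right ht), fun r hr => h.2 r ⟨hr.1, hr.2.trans ht⟩⟩

/-- `log (1 + log (1 + |x|²))`, which controls the growth of solutions. -/
noncomputable def logLog {n : ℕ} (x : E n) : ℝ := Real.log (1 + Real.log (1 + ‖x‖ ^ 2))

theorem contDiff_logLog : ContDiff ℝ 1 (logLog (n := n)) := by
  unfold logLog
  have h1 : ContDiff ℝ 1 fun x : E n => 1 + ‖x‖ ^ 2 :=
    contDiff_const.add (contDiff_norm_sq ℝ)
  have h2 := h1.log fun x => by positivity
  refine (contDiff_const.add h2).log fun x => ?_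
  have : 0 ≤ Real.log (1 + ‖x‖ ^ 2) := Real.log_nonneg (by nlinarith [sq_nonneg ‖x‖])
  positivity

/-- With `L = log (1 + |x|²)` the derivative is `2 ⟨x, v⟩ / ((1 + |x|²)(1 + L))`, and `log⁺ |x| ≤ 1
+ L` cancels the logarithm in the growth of `v`. The constant is `1 + 2`, from `2|x| ≤ 1 + |x|²` and
`2|x|² ≤ 2(1 + |x|²)`. -/
theorem fderiv_logLog_le {g : ℝ} (hg : 0 ≤ g) {v : E n}
    (hv : ‖v‖ ≤ g * (1 + ‖x‖ * logPlus ‖x‖)) : fderiv ℝ logLog x v ≤ 3 * g := by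
  set q := ‖x‖ with hq
  have hq0 : 0 ≤ q := norm_nonneg x
  set L := Real.log (1 + q ^ 2) with hL
  have hL0 : 0 ≤ L := Real.log_nonneg (by nlinarith [sq_nonneg q])
  have hp : (0 : ℝ) < 1 + q ^ 2 := by positivity
  have h1 : HasFDerivAt (fun x : E n => ‖x‖ ^ 2) (2 • innerSL ℝ x) x :=
    (hasStrictFDerivAt_norm_sq x).hasFDerivAt
  have h2 := ((h1.const_add 1).log hp.ne').const_add 1
  have h3 := h2.log (by positivity : 1 + Real.log (1 + ‖x‖ ^ 2) ≠ 0)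
  have e : fderiv ℝ logLog x v = (1 + L)⁻¹ * ((1 + q ^ 2)⁻¹ * (2 * inner ℝ x v)) := by
    have : fderiv ℝ logLog x = _ := h3.fderiv
    rw [this]
    simp [hL, hq]
  rw [e]
  have h4 : inner ℝ x v ≤ q * (g * (1 + q * logPlus q)) :=
    (real_inner_le_norm x v).trans (mul_le_mul_of_nonneg_left hv hq0)
  have h5 : logPlus q ≤ 1 + L := by
    refine max_le (by linarith) ?_
    rcases hq0.eq_or_lt with h | h
    · rw [← h, Real.log_zero]; positivity
    · have := Real.log_le_log h (by nlinarith [sq_nonneg (q - 1)] : q ≤ 1 + q ^ 2)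
      linarith
  rw [inv_mul_le_iff₀ (by positivity), inv_mul_le_iff₀ hp]
  have h6 : q ^ 2 * logPlus q ≤ q ^ 2 * (1 + L) := mul_le_mul_of_nonneg_left h5 (sq_nonneg q)
  have h7 : 2 * q ≤ 1 + q ^ 2 := by nlinarith [sq_nonneg (q - 1)]
  have h8 : 2 * (q * (1 + q * logPlus q)) ≤ (1 + q ^ 2) * ((1 + L) * 3) := by
    nlinarith [mul_nonneg hL0 (sq_nonneg q)]
  nlinarith [mul_le_mul_of_nonneg_left h8 hg]

/-- A priori bound for curves whose velocity grows at most like `|x| log |x|`. -/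
theorem norm_le_of_growth {v : ℝ → E n} (h : IsPrimitive y v s T) {g : ℝ → ℝ}
    (hg : Integrable g) (hg0 : ∀ r, 0 ≤ g r)
    (hv : ∀ r ∈ Icc s T, ‖v r‖ ≤ g r * (1 + ‖y r‖ * logPlus ‖y r‖)) :
    ∀ t ∈ Icc s T, ‖y t‖ ≤ Real.exp (Real.exp (logLog (y s) + 3 * ∫ r, g r)) := by
  intro t ht
  have h1 := ((h.mono ht).comp contDiff_logLog).le_add_integral (w := fun r => 3 * g r)
    (hg.intervalIntegrable.const_mul 3)
    (fun r hr => fderiv_logLog_le (hg0 r) (hv r ⟨hr.1, hr.2.trans ht.2⟩))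
  have h2 : ∫ r in s..t, g r ≤ ∫ r, g r := by
    rw [intervalIntegral.integral_of_le ht.1]
    exact setIntegral_le_integral hg (Eventually.of_forall hg0)
  rw [intervalIntegral.integral_const_mul] at h1
  have hL0 : 0 ≤ Real.log (1 + ‖y t‖ ^ 2) := Real.log_nonneg (by nlinarith [sq_nonneg ‖y t‖])
  have h3 : logLog (y t) ≤ logLog (y s) + 3 * ∫ r, g r := by linarith
  have h4 : 1 + Real.log (1 + ‖y t‖ ^ 2) ≤ Real.exp (logLog (y s) + 3 * ∫ r, g r) :=
    (Real.log_le_iff_le_exp (by positivity)).1 h3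
  have h5 : 1 + ‖y t‖ ^ 2 ≤ Real.exp (Real.exp (logLog (y s) + 3 * ∫ r, g r)) :=
    (Real.log_le_iff_le_exp (by positivity)).1 (by linarith)
  nlinarith [sq_nonneg (‖y t‖ - 1)]

/-- Solutions with values in a ball, where `f` is Lipschitz, separate at most exponentially, in
both directions of time. -/
theorem norm_sub_mul_exp_le (hy : IsSol f s T x y) (hz : IsSol f s T x' z) (hsT : s ≤ T)
    {ℓ : ℝ → ℝ} (hℓ : Integrable ℓ)
    (hL : ∀ r ∈ Icc s T, ‖f r (y r) - f r (z r)‖ ≤ ℓ r * ‖y r - z r‖) :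
    ‖y T - z T‖ ≤ ‖x - x'‖ * Real.exp (∫ r in s..T, ℓ r) ∧
      ‖x - x'‖ ≤ ‖y T - z T‖ * Real.exp (∫ r in s..T, ℓ r) := by
  -- Along the pair `(y - z, ∫ ℓ)`, the function `‖y - z‖² exp (c ∫ ℓ)` is nonincreasing for `c =
  -- -2` and nondecreasing for `c = 2`. The square makes it differentiable where `y = z`.
  have hp := ((hy.isPrimitive hsT).sub (hz.isPrimitive hsT)).prodMk
    (IsPrimitive.primitive hsT hℓ.intervalIntegrable)
  have hφ : ∀ c : ℝ, ContDiff ℝ 1 fun p : E n × ℝ => ‖p.1‖ ^ 2 * Real.exp (c * p.2) := fun c =>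
    (contDiff_fst.norm_sq ℝ).mul (by fun_prop)
  have hd : ∀ (c : ℝ) (p v : E n × ℝ),
      fderiv ℝ (fun p : E n × ℝ => ‖p.1‖ ^ 2 * Real.exp (c * p.2)) p v =
        Real.exp (c * p.2) * (2 * inner ℝ p.1 v.1 + c * v.2 * ‖p.1‖ ^ 2) := by
    intro c p v
    have h1 : HasFDerivAt (fun p : E n × ℝ => ‖p.1‖ ^ 2) _ p := hasFDerivAt_fst.norm_sq
    have h2 : HasFDerivAt (fun p : E n × ℝ => Real.exp (c * p.2)) _ p :=
      (hasFDerivAt_snd.const_mul c).exp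
    have h3 : HasFDerivAt (fun p : E n × ℝ => ‖p.1‖ ^ 2 * Real.exp (c * p.2)) _ p := h1.mul h2
    rw [h3.fderiv]
    simp
    ring
  have hin : ∀ r ∈ Icc s T, |inner ℝ (y r - z r) (f r (y r) - f r (z r))| ≤
      ℓ r * ‖y r - z r‖ ^ 2 := by
    intro r hr
    refine (abs_real_inner_le_norm _ _).trans ?_
    have := mul_le_mul_of_nonneg_left (hL r hr) (norm_nonneg (y r - z r))
    nlinarith
  have hs := hy.init hsT
  have hs' := hz.init hsT
  set Λ := ∫ r in s..T, ℓ r with hΛ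
  have hexp : Real.exp (2 * Λ) = Real.exp Λ ^ 2 := by rw [← Real.exp_nat_mul]; norm_num
  constructor
  · have h1 := (hp.comp (hφ (-2))).le_of_deriv_nonpos (fun r hr => by
      rw [hd]
      refine mul_nonpos_of_nonneg_of_nonpos (Real.exp_pos _).le ?_
      have := abs_le.1 (hin r hr)
      simp only
      linarith [this.2])
    simp only [intervalIntegral.integral_same, mul_zero, Real.exp_zero, mul_one, hs, hs'] at h1
    rw [← hΛ, show -2 * Λ = -(2 * Λ) by ring, Real.exp_neg, hexp,
      mul_inv_le_iff₀ (by positivity), ← mul_pow] at h1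
    exact (pow_le_pow_iff_left₀ (norm_nonneg _) (by positivity) two_ne_zero).1 h1
  · have h1 := (hp.comp (hφ 2)).le_of_deriv_nonneg (fun r hr => by
      rw [hd]
      refine mul_nonneg (Real.exp_pos _).le ?_
      have := abs_le.1 (hin r hr)
      simp only
      linarith [this.1])
    simp only [intervalIntegral.integral_same, mul_zero, Real.exp_zero, mul_one, hs, hs'] at h1
    rw [← hΛ, hexp, ← mul_pow] at h1
    exact (pow_le_pow_iff_left₀ (norm_nonneg _) (by positivity) two_ne_zero).1 h1

end Solutions

/-! ### Regular fields and their flows -/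

/-- The regularity of `b` used to construct and differentiate its flow, for a field defined at all
times. -/
structure RegularField {n : ℕ} (f : ℝ → E n → E n) : Prop where
  measurable : Measurable (Function.uncurry f)
  contDiff : ∀ t, ContDiff ℝ 1 (f t)
  locLipschitz : ∀ R : ℝ, ∃ ℓ : ℝ → ℝ, Integrable ℓ ∧ (∀ t, 0 ≤ ℓ t) ∧
    ∀ t x, ‖x‖ ≤ R → ‖fderiv ℝ (f t) x‖ ≤ ℓ t
  growth : ∃ g : ℝ → ℝ, Integrable g ∧ (∀ t, 0 ≤ g t) ∧
    ∀ t x, ‖f t x‖ ≤ g t * (1 + ‖x‖ * logPlus ‖x‖)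

/-- The retraction of the space onto the ball of radius `N`. -/
noncomputable def ballRetract {n : ℕ} (N : ℝ) (x : E n) : E n := (N / max N ‖x‖) • x

section Retract

variable {n : ℕ} {N : ℝ}

theorem ballRetract_eq_self (hN : 0 < N) {x : E n} (hx : ‖x‖ ≤ N) : ballRetract N x = x := by
  rw [ballRetract, max_eq_left hx, div_self hN.ne', one_smul]

theorem norm_ballRetract (hN : 0 < N) (x : E n) : ‖ballRetract N x‖ = N / max N ‖x‖ * ‖x‖ := by
  rw [ballRetract, norm_smul, Real.norm_of_nonneg (by positivity)]

theorem norm_ballRetract_le (hN : 0 < N) (x : E n) : ‖ballRetract N x‖ ≤ N := by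
  rw [norm_ballRetract hN, div_mul_eq_mul_div, div_le_iff₀ (by positivity)]
  exact mul_le_mul_of_nonneg_left (le_max_right _ _) hN.le

theorem norm_ballRetract_le_norm (hN : 0 < N) (x : E n) : ‖ballRetract N x‖ ≤ ‖x‖ := by
  rw [norm_ballRetract hN]
  exact mul_le_of_le_one_left (norm_nonneg _)
    ((div_le_one (by positivity)).2 (le_max_left _ _))

theorem norm_ballRetract_sub_le (hN : 0 < N) (x y : E n) :
    ‖ballRetract N x - ballRetract N y‖ ≤ 2 * ‖x - y‖ := by
  set a := max N ‖x‖ with ha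
  set b := max N ‖y‖ with hb
  have ha0 : 0 < a := lt_max_of_lt_left hN
  have hb0 : 0 < b := lt_max_of_lt_left hN
  have e : ballRetract N x - ballRetract N y = (N / a) • (x - y) + (N / a - N / b) • y := by
    simp only [ballRetract, ← ha, ← hb]
    module
  have h1 : N / a ≤ 1 := (div_le_one ha0).2 (le_max_left _ _)
  have h2 : |b - a| ≤ ‖x - y‖ := by
    rw [ha, hb, max_comm N, max_comm N, norm_sub_rev]
    exact (abs_max_sub_max_le_abs _ _ _).trans (abs_norm_sub_norm_le _ _)
  have h3 : |N / a - N / b| * ‖y‖ ≤ ‖x - y‖ := by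
    have e2 : N / a - N / b = N / a * ((b - a) / b) := by field_simp
    rw [e2, abs_mul, abs_of_nonneg (by positivity : 0 ≤ N / a), abs_div, abs_of_pos hb0]
    have h4 : |b - a| / b * ‖y‖ ≤ |b - a| := by
      rw [div_mul_eq_mul_div, div_le_iff₀ hb0]
      exact mul_le_mul_of_nonneg_left (le_max_right _ _) (abs_nonneg _)
    calc N / a * (|b - a| / b) * ‖y‖ = N / a * (|b - a| / b * ‖y‖) := by ring
      _ ≤ 1 * ‖x - y‖ := mul_le_mul h1 (h4.trans h2) (by positivity) zero_le_one
      _ = _ := one_mul _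
  rw [e]
  refine (norm_add_le _ _).trans ?_
  rw [norm_smul, norm_smul, Real.norm_eq_abs, Real.norm_eq_abs,
    abs_of_nonneg (by positivity : 0 ≤ N / a)]
  nlinarith [norm_nonneg (x - y)]

theorem measurable_ballRetract : Measurable (ballRetract N : E n → E n) := by
  unfold ballRetract
  fun_prop

end Retract

section Flow

variable {n : ℕ} {f : ℝ → E n → E n}

theorem RegularField.norm_sub_le (hf : RegularField f) {R : ℝ} {ℓ : ℝ → ℝ}
    (hℓ : ∀ t x, ‖x‖ ≤ R → ‖fderiv ℝ (f t) x‖ ≤ ℓ t) (t : ℝ) {x y : E n} (hx : ‖x‖ ≤ R)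
    (hy : ‖y‖ ≤ R) : ‖f t x - f t y‖ ≤ ℓ t * ‖x - y‖ :=
  (convex_closedBall (0 : E n) R).norm_image_sub_le_of_norm_fderiv_le
    (fun z _ => (hf.contDiff t).differentiable one_ne_zero z)
    (fun z hz => hℓ t z (mem_closedBall_zero_iff.1 hz))
    (mem_closedBall_zero_iff.2 hy) (mem_closedBall_zero_iff.2 hx)

/-- An a priori bound for the solutions starting at `x`, for a field whose growth is controlled by
a function of time with integral `G`. -/
noncomputable def solBound {n : ℕ} (G : ℝ) (x : E n) : ℝ :=
  Real.exp (Real.exp (logLog x + 3 * G))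

theorem continuous_solBound (G : ℝ) : Continuous (solBound (n := n) G) := by
  have := (contDiff_logLog (n := n)).continuous
  unfold solBound
  fun_prop

/-- Composing with `ballRetract` makes the field globally Lipschitz in space and keeps the same
growth bound, so the a priori bound does not depend on the truncation radius. A trajectory whose
radius exceeds its own bound never meets the truncation. -/
theorem RegularField.exists_flow (hf : RegularField f) :
    ∃ X : ℝ → ℝ → E n → E n, Measurable (fun p : ℝ × ℝ × E n => X p.1 p.2.1 p.2.2) ∧
      ∀ s T, s ≤ T → ∀ x, IsSol f s T x (fun t => X s t x) := by
  obtain ⟨g, hg, hg0, hgf⟩ := hf.growth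
  have hm : ∀ N : ℝ, 0 < N → Measurable (Function.uncurry fun t x => f t (ballRetract N x)) :=
    fun N hN => hf.measurable.comp
      (measurable_fst.prodMk (measurable_ballRetract.comp measurable_snd))
  have hgrow : ∀ N : ℝ, 0 < N → ∀ t x,
      ‖f t (ballRetract N x)‖ ≤ g t * (1 + ‖x‖ * logPlus ‖x‖) := by
    intro N hN t x
    refine (hgf _ _).trans (mul_le_mul_of_nonneg_left ?_ (hg0 t))
    have h1 := norm_ballRetract_le_norm hN x
    have h2 := logPlus_mono (norm_nonneg _) h1
    have h3 := one_le_logPlus ‖ballRetract N x‖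
    gcongr
  have hex : ∀ N : ℕ, ∃ X : ℝ → ℝ → E n → E n,
      Measurable (fun p : ℝ × ℝ × E n => X p.1 p.2.1 p.2.2) ∧
      ∀ s x, IntegrableOn (fun r => f r (ballRetract (N + 1) (X s r x))) (Ioi s) ∧
        ∀ t, s ≤ t → X s t x = x + ∫ r in s..t, f r (ballRetract (N + 1) (X s r x)) := by
    intro N
    have hN : (0 : ℝ) < N + 1 := by positivity
    obtain ⟨ℓ, hℓ, hℓ0, hℓf⟩ := hf.locLipschitz (N + 1)
    refine exists_solution_of_lipschitz (f := fun t x => f t (ballRetract (N + 1) x))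
      (ℓ := fun t => 2 * ℓ t) (hm _ hN) (hℓ.const_mul 2)
      (fun r => mul_nonneg zero_le_two (hℓ0 r)) (fun t x y => ?_) (fun x => ?_)
    · refine (hf.norm_sub_le hℓf t (norm_ballRetract_le hN x) (norm_ballRetract_le hN y)).trans ?_
      have := mul_le_mul_of_nonneg_left (norm_ballRetract_sub_le hN x y) (hℓ0 t)
      linarith
    · exact (hg.mul_const (1 + ‖x‖ * logPlus ‖x‖)).mono'
        ((hm _ hN).comp (measurable_id.prodMk measurable_const)).aestronglyMeasurable
        (Eventually.of_forall fun t => hgrow _ hN t x)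
  choose X hXm hX using hex
  -- The radius is an integer depending measurably on `x`, so patching the countably many truncated
  -- flows preserves joint measurability.
  set N : E n → ℕ := fun x => ⌈solBound (∫ r, g r) x⌉₊ with hN
  have hNm : Measurable N := Nat.measurable_ceil.comp (continuous_solBound _).measurable
  refine ⟨fun s t x => X (N x) s t x, ?_, fun s T hsT x => ?_⟩
  · have h1 : Measurable fun q : ℕ × (ℝ × ℝ × E n) => X q.1 q.2.1 q.2.2.1 q.2.2.2 :=
      measurable_from_prod_countable_right hXm
    exact h1.comp ((hNm.comp measurable_snd.snd).prodMk measurable_id)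
  · obtain ⟨hi, he⟩ := hX (N x) s x
    have hpos : (0 : ℝ) < (N x : ℝ) + 1 := by positivity
    have hi' : IntegrableOn (fun r => f r (ballRetract (N x + 1) (X (N x) s r x))) (Icc s T) := by
      rw [integrableOn_Icc_iff_integrableOn_Ioc]
      exact hi.mono_set Ioc_subset_Ioi_self
    have hs : X (N x) s s x = x := by simpa using he s le_rfl
    have hprim : IsPrimitive (fun t => X (N x) s t x)
        (fun r => f r (ballRetract (N x + 1) (X (N x) s r x))) s T :=
      ⟨hsT, (intervalIntegrable_iff_integrableOn_Icc_of_le hsT).2 hi',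
        fun t ht => by rw [hs]; exact he t ht.1⟩
    have hb : ∀ t ∈ Icc s T, ballRetract (N x + 1) (X (N x) s t x) = X (N x) s t x := by
      intro t ht
      refine ballRetract_eq_self hpos ?_
      have h1 := norm_le_of_growth hprim hg hg0 (fun r _ => hgrow _ hpos r _) t ht
      rw [hs] at h1
      have h2 : solBound (∫ r, g r) x ≤ N x := Nat.le_ceil _
      exact (h1.trans h2).trans (by linarith)
    refine ⟨hi'.congr_fun (fun r hr => by simp only [hb r hr]) measurableSet_Icc, fun t ht => ?_⟩
    simp only
    rw [he t ht.1]
    congr 1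
    refine intervalIntegral.integral_congr fun r hr => ?_
    rw [uIcc_of_le ht.1] at hr
    simp only [hb r ⟨hr.1, hr.2.trans ht.2⟩]

/-- A common radius and Lipschitz rate for all solutions starting in a bounded set. -/
theorem RegularField.exists_lipschitz_rate (hf : RegularField f) (x₀ : E n) :
    ∃ R : ℝ, ∃ ℓ : ℝ → ℝ, Integrable ℓ ∧ (∀ t, 0 ≤ ℓ t) ∧
      (∀ t x, ‖x‖ ≤ R → ‖fderiv ℝ (f t) x‖ ≤ ℓ t) ∧
      ∀ x ∈ Metric.closedBall x₀ 1, ∀ s T y, IsSol f s T x y → ∀ t ∈ Icc s T, ‖y t‖ ≤ R := by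
  obtain ⟨g, hg, hg0, hgf⟩ := hf.growth
  obtain ⟨R, hR⟩ := (isCompact_closedBall x₀ 1).bddAbove_image
    (continuous_solBound (n := n) (∫ r, g r)).continuousOn
  obtain ⟨ℓ, hℓ, hℓ0, hℓf⟩ := hf.locLipschitz R
  refine ⟨R, ℓ, hℓ, hℓ0, hℓf, fun x hx s T y hy t ht => ?_⟩
  have hsT := ht.1.trans ht.2
  have h1 := norm_le_of_growth (hy.isPrimitive hsT) hg hg0 (fun r _ => hgf r _) t ht
  rw [hy.init hsT] at h1
  exact h1.trans (hR (mem_image_of_mem _ hx))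

theorem RegularField.eq_of_isSol (hf : RegularField f) {s T : ℝ} {x : E n} {y z : ℝ → E n}
    (hy : IsSol f s T x y) (hz : IsSol f s T x z) (hsT : s ≤ T) : y T = z T := by
  obtain ⟨R, ℓ, hℓ, hℓ0, hℓf, hb⟩ := hf.exists_lipschitz_rate x
  have hx : x ∈ Metric.closedBall x 1 := Metric.mem_closedBall_self zero_le_one
  have h := (norm_sub_mul_exp_le hy hz hsT hℓ fun r hr =>
    hf.norm_sub_le hℓf r (hb x hx s T y hy r hr) (hb x hx s T z hz r hr)).1
  rw [sub_self, norm_zero, zero_mul, norm_le_zero_iff, sub_eq_zero] at h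
  exact h

/-- Backward uniqueness, from the lower estimate of `norm_sub_mul_exp_le`. It makes the flow maps
injective, as the change of variables requires. -/
theorem RegularField.eq_of_eq_at_end (hf : RegularField f) {s T : ℝ} {x x' : E n}
    {y z : ℝ → E n} (hy : IsSol f s T x y) (hz : IsSol f s T x' z) (hsT : s ≤ T)
    (h : y T = z T) : x = x' := by
  obtain ⟨R, ℓ, hℓ, hℓ0, hℓf, hb⟩ := hf.exists_lipschitz_rate x
  obtain ⟨R', ℓ', hℓ', hℓ0', hℓf', hb'⟩ := hf.exists_lipschitz_rate x'
  obtain ⟨m, hm, hm0, hmf⟩ := hf.locLipschitz (max R R')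
  have h := (norm_sub_mul_exp_le hy hz hsT hm fun r hr =>
    hf.norm_sub_le hmf r
      ((hb x (Metric.mem_closedBall_self zero_le_one) s T y hy r hr).trans (le_max_left _ _))
      ((hb' x' (Metric.mem_closedBall_self zero_le_one) s T z hz r hr).trans
        (le_max_right _ _))).2
  rw [‹y T = z T›, sub_self, norm_zero, zero_mul, norm_le_zero_iff, sub_eq_zero] at h
  exact h

end Flow

/-! ### Differentiability of the flow and Liouville's formula -/

section Derivative

variable {n : ℕ}

theorem clm_eq_sum_smulRight (A : E n →L[ℝ] E n) :
    A = ∑ j, (EuclideanSpace.proj j : E n →L[ℝ] ℝ).smulRight (A (EuclideanSpace.single j 1)) := by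
  ext x : 1
  have : x = ∑ j, x j • (EuclideanSpace.single j (1 : ℝ) : E n) := by
    simpa using ((EuclideanSpace.basisFun (Fin n) ℝ).sum_repr x).symm
  conv_lhs => rw [this]
  simp

/-- The field is only Borel in time, so joint measurability comes from the limit of difference
quotients, one direction at a time; the operator is then reassembled from its columns. -/
theorem measurable_fderiv_of_contDiff {f : ℝ → E n → E n} (hf : Measurable (Function.uncurry f))
    (hd : ∀ t, Differentiable ℝ (f t)) :
    Measurable fun p : ℝ × E n => fderiv ℝ (f p.1) p.2 := by
  have hv : ∀ v : E n, Measurable fun p : ℝ × E n => fderiv ℝ (f p.1) p.2 v := by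
    intro v
    refine measurable_of_tendsto_metrizable (f := fun (k : ℕ) (p : ℝ × E n) =>
      (k : ℝ) • (f p.1 (p.2 + (k : ℝ)⁻¹ • v) - f p.1 p.2)) (fun k => ?_) ?_
    · have h : Measurable fun p : ℝ × E n => f p.1 (p.2 + (k : ℝ)⁻¹ • v) - f p.1 p.2 :=
        (hf.comp (measurable_fst.prodMk (measurable_snd.add_const _))).sub hf
      exact h.const_smul (k : ℝ)
    · refine tendsto_pi_nhds.2 fun p => ?_
      refine (hd p.1 p.2).hasFDerivAt.lim v ?_
      simpa using tendsto_natCast_atTop_atTop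
  have : (fun p : ℝ × E n => fderiv ℝ (f p.1) p.2) = fun p => ∑ j,
      (EuclideanSpace.proj j : E n →L[ℝ] ℝ).smulRight
        (fderiv ℝ (f p.1) p.2 (EuclideanSpace.single j 1)) := by
    ext1 p
    exact clm_eq_sum_smulRight _
  rw [this]
  refine Finset.measurable_sum _ fun j _ => ?_
  exact ((ContinuousLinearMap.smulRightL ℝ (E n) (E n)
    (EuclideanSpace.proj j)).continuous.measurable).comp (hv _)

theorem measurable_clm_comp {α : Type*} [MeasurableSpace α] {A B : α → E n →L[ℝ] E n}
    (hA : Measurable A) (hB : Measurable B) : Measurable fun a => (A a).comp (B a) :=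
  (isBoundedBilinearMap_comp (𝕜 := ℝ) (E := E n) (F := E n)
    (G := E n)).continuous.measurable.comp (hA.prodMk hB)

theorem measurable_clm_apply {α : Type*} [MeasurableSpace α] {A : α → E n →L[ℝ] E n}
    {y : α → E n} (hA : Measurable A) (hy : Measurable y) : Measurable fun a => A a (y a) :=
  (isBoundedBilinearMap_apply (𝕜 := ℝ) (E := E n) (F := E n)).continuous.measurable.comp
    (hA.prodMk hy)

/-- The fundamental solution of a linear equation with integrable coefficients. -/
theorem exists_linear_solution {A : ℝ → E n →L[ℝ] E n} (hA : Measurable A) {ℓ : ℝ → ℝ}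
    (hℓ : Integrable ℓ) {s T : ℝ} (hsT : s ≤ T) (hAℓ : ∀ r ∈ Icc s T, ‖A r‖ ≤ ℓ r) :
    ∃ Z : ℝ → E n →L[ℝ] E n, IsPrimitive Z (fun r => (A r).comp (Z r)) s T ∧
      Z s = ContinuousLinearMap.id ℝ (E n) := by
  -- The bound on `A` holds only on `[s, T]`; cutting `A` to zero elsewhere allows global existence
  -- in the space of operators.
  set B : ℝ → E n →L[ℝ] E n := (Icc s T).indicator A with hB
  have hBm : Measurable B := hA.indicator measurableSet_Icc
  have hBℓ : ∀ r, ‖B r‖ ≤ |ℓ r| := by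
    intro r
    by_cases hr : r ∈ Icc s T
    · rw [hB, indicator_of_mem hr]; exact (hAℓ r hr).trans (le_abs_self _)
    · rw [hB, indicator_of_notMem hr, norm_zero]; exact abs_nonneg _
  obtain ⟨X, hX, hXs⟩ := exists_solution_of_lipschitz
    (f := fun r (Z : E n →L[ℝ] E n) => (B r).comp Z) (ℓ := fun r => |ℓ r|)
    (measurable_clm_comp (hBm.comp measurable_fst) measurable_snd) hℓ.abs (fun r => abs_nonneg _)
    (fun t x y => by
      rw [← ContinuousLinearMap.comp_sub]
      exact (ContinuousLinearMap.opNorm_comp_le _ _).trans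
        (mul_le_mul_of_nonneg_right (hBℓ t) (norm_nonneg _)))
    (fun Z => (hℓ.abs.mul_const ‖Z‖).mono'
      (measurable_clm_comp hBm measurable_const).aestronglyMeasurable
      (Eventually.of_forall fun r => (ContinuousLinearMap.opNorm_comp_le _ _).trans
        (mul_le_mul_of_nonneg_right (hBℓ r) (norm_nonneg _))))
  obtain ⟨hi, he⟩ := hXs s (ContinuousLinearMap.id ℝ (E n))
  have hs : X s s (ContinuousLinearMap.id ℝ (E n)) = ContinuousLinearMap.id ℝ (E n) := by
    simpa using he s le_rfl
  have hp : IsPrimitive (fun t => X s t (ContinuousLinearMap.id ℝ (E n)))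
      (fun r => (B r).comp (X s r (ContinuousLinearMap.id ℝ (E n)))) s T :=
    ⟨hsT, (intervalIntegrable_iff_integrableOn_Ioc_of_le hsT).2 (hi.mono_set Ioc_subset_Ioi_self),
      fun t ht => by rw [hs]; exact he t ht.1⟩
  refine ⟨fun t => X s t (ContinuousLinearMap.id ℝ (E n)), hp.congr_deriv fun r hr => ?_, hs⟩
  simp only [hB, indicator_of_mem hr]

variable {f : ℝ → E n → E n}

/-- The flow is differentiable in the initial point, and its derivative solves the linearized
equation. -/
theorem RegularField.hasFDerivAt_flow (hf : RegularField f) {X : ℝ → ℝ → E n → E n}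
    (hXm : Measurable (fun p : ℝ × ℝ × E n => X p.1 p.2.1 p.2.2)) {s T : ℝ} (hsT : s ≤ T)
    (hX : ∀ x, IsSol f s T x (fun t => X s t x)) (x₀ : E n) :
    ∃ Z : ℝ → E n →L[ℝ] E n,
      IsPrimitive Z (fun r => (fderiv ℝ (f r) (X s r x₀)).comp (Z r)) s T ∧
      Z s = ContinuousLinearMap.id ℝ (E n) ∧ HasFDerivAt (X s T) (Z T) x₀ := by
  obtain ⟨R, ℓ, hℓ, hℓ0, hℓf, hb⟩ := hf.exists_lipschitz_rate x₀
  have hx₀ : x₀ ∈ Metric.closedBall x₀ 1 := Metric.mem_closedBall_self zero_le_one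
  have hXc : ∀ x, Measurable fun r => X s r x := fun x =>
    hXm.comp (measurable_const.prodMk (measurable_id.prodMk measurable_const))
  have hbd : ∀ x ∈ Metric.closedBall x₀ 1, ∀ t ∈ Icc s T, ‖X s t x‖ ≤ R := fun x hx t ht =>
    hb x hx s T _ (hX x) t ht
  set A : ℝ → E n →L[ℝ] E n := fun r => fderiv ℝ (f r) (X s r x₀) with hA
  have hAm : Measurable A :=
    (measurable_fderiv_of_contDiff hf.measurable
      fun t => (hf.contDiff t).differentiable one_ne_zero).comp (measurable_id.prodMk (hXc x₀))
  have hAℓ : ∀ r ∈ Icc s T, ‖A r‖ ≤ ℓ r := fun r hr => hℓf r _ (hbd x₀ hx₀ r hr)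
  obtain ⟨Z, hZ, hZs⟩ := exists_linear_solution hAm hℓ hsT hAℓ
  refine ⟨Z, hZ, hZs, ?_⟩
  set Λ := ∫ r in s..T, ℓ r with hΛ
  -- Lipschitz bound for the flow
  have hlip : ∀ x ∈ Metric.closedBall x₀ 1, ∀ t ∈ Icc s T,
      ‖X s t x - X s t x₀‖ ≤ Real.exp Λ * ‖x - x₀‖ := by
    intro x hx t ht
    have h1 := (norm_sub_mul_exp_le ((hX x).mono ht.2) ((hX x₀).mono ht.2) ht.1 hℓ fun r hr =>
      hf.norm_sub_le hℓf r (hbd x hx r ⟨hr.1, hr.2.trans ht.2⟩)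
        (hbd x₀ hx₀ r ⟨hr.1, hr.2.trans ht.2⟩)).1
    refine h1.trans ?_
    rw [mul_comm]
    have : ∫ r in s..t, ℓ r ≤ Λ := intervalIntegral.integral_mono_interval le_rfl ht.1 ht.2
      (Eventually.of_forall hℓ0) hℓ.intervalIntegrable
    gcongr
  -- `ρ` is the first-order remainder of `f` along the trajectories. The error `X(x) - X(x₀) - Z(x -
  -- x₀)` solves the linearized equation with source `ρ`, so by Grönwall it suffices that `∫ ‖ρ‖ =
  -- o(‖x - x₀‖)`. This follows by dominated convergence, with dominating function `2 ℓ exp Λ`.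
  set ρ : E n → ℝ → E n := fun x r =>
    f r (X s r x) - f r (X s r x₀) - A r (X s r x - X s r x₀) with hρ
  have hρm : ∀ x, Measurable (ρ x) := fun x =>
    ((hf.measurable.comp (measurable_id.prodMk (hXc x))).sub
      (hf.measurable.comp (measurable_id.prodMk (hXc x₀)))).sub
      (measurable_clm_apply hAm ((hXc x).sub (hXc x₀)))
  have hρle : ∀ x ∈ Metric.closedBall x₀ 1, ∀ r ∈ Icc s T,
      ‖ρ x r‖ ≤ 2 * ℓ r * (Real.exp Λ * ‖x - x₀‖) := by
    intro x hx r hr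
    have h1 := hf.norm_sub_le hℓf r (hbd x hx r hr) (hbd x₀ hx₀ r hr)
    have h2 : ‖A r (X s r x - X s r x₀)‖ ≤ ℓ r * ‖X s r x - X s r x₀‖ :=
      ((A r).le_opNorm _).trans (mul_le_mul_of_nonneg_right (hAℓ r hr) (norm_nonneg _))
    have h3 := _root_.norm_sub_le (f r (X s r x) - f r (X s r x₀)) (A r (X s r x - X s r x₀))
    have h4 := mul_le_mul_of_nonneg_left (hlip x hx r hr) (hℓ0 r)
    simp only [hρ]
    linarith
  have hρi : ∀ x ∈ Metric.closedBall x₀ 1, IntegrableOn (ρ x) (Icc s T) := by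
    intro x hx
    refine Integrable.mono' ((hℓ.const_mul 2).mul_const (Real.exp Λ * ‖x - x₀‖)).integrableOn
      (hρm x).aestronglyMeasurable ?_
    exact (ae_restrict_iff' measurableSet_Icc).2 (Eventually.of_forall fun r hr => hρle x hx r hr)
  have hmain : ∀ x ∈ Metric.closedBall x₀ 1,
      ‖X s T x - X s T x₀ - Z T (x - x₀)‖ ≤
        2 * (∫ r in Icc s T, ‖ρ x r‖) * Real.exp (2 * Λ) := by
    intro x hx
    have hp : IsPrimitive (fun t => X s t x - X s t x₀ - Z t (x - x₀))
        (fun r => f r (X s r x) - f r (X s r x₀) - A r (Z r (x - x₀))) s T := by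
      refine (((hX x).isPrimitive hsT).sub ((hX x₀).isPrimitive hsT)).sub ⟨hsT, ?_, ?_⟩
      · have h1 := hZ.integrable
        rw [intervalIntegrable_iff_integrableOn_Ioc_of_le hsT] at h1 ⊢
        exact (ContinuousLinearMap.apply ℝ (E n) (x - x₀)).integrable_comp h1
      · intro t ht
        have h1 := (hZ.mono ht).integrable
        have h2 := congrArg (ContinuousLinearMap.apply ℝ (E n) (x - x₀)) (hZ.eq t ht)
        rw [map_add, ← ContinuousLinearMap.intervalIntegral_comp_comm _ h1] at h2
        exact h2
    have hg := gronwall_weak (ℓ := ℓ) (u := fun t => ‖X s t x - X s t x₀ - Z t (x - x₀)‖)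
      (A := ∫ r in Icc s T, ‖ρ x r‖) (integral_nonneg fun _ => norm_nonneg _)
      hℓ.intervalIntegrable hℓ0 hp.continuousOn.norm (fun t ht => ?_) T ⟨hsT, le_rfl⟩
    · exact hg
    · have e := hp.eq t ht
      have hs0 : X s s x - X s s x₀ - Z s (x - x₀) = 0 := by
        have h1 : X s s x = x := (hX x).init hsT
        have h2 : X s s x₀ = x₀ := (hX x₀).init hsT
        rw [h1, h2, hZs]; simp
      simp only [hs0, zero_add] at e
      rw [e]
      refine (intervalIntegral.norm_integral_le_integral_norm ht.1).trans ?_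
      have hi1 : IntervalIntegrable (fun r => ‖ρ x r‖) volume s t :=
        (intervalIntegrable_iff_integrableOn_Icc_of_le ht.1).2
          (IntegrableOn.mono_set (hρi x hx).norm (Icc_subset_Icc_right ht.2))
      have hi2 : IntervalIntegrable
          (fun r => ℓ r * ‖X s r x - X s r x₀ - Z r (x - x₀)‖) volume s t := by
        refine hℓ.intervalIntegrable.mul_continuousOn ?_
        rw [uIcc_of_le ht.1]
        exact (hp.mono ht).continuousOn.norm
      have h1 : ∫ r in s..t, ‖f r (X s r x) - f r (X s r x₀) - A r (Z r (x - x₀))‖ ≤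
          ∫ r in s..t, (‖ρ x r‖ + ℓ r * ‖X s r x - X s r x₀ - Z r (x - x₀)‖) := by
        refine intervalIntegral.integral_mono_on ht.1 (hp.mono ht).integrable.norm (hi1.add hi2)
          fun r hr => ?_
        have e2 : f r (X s r x) - f r (X s r x₀) - A r (Z r (x - x₀)) =
            ρ x r + A r (X s r x - X s r x₀ - Z r (x - x₀)) := by
          simp only [hρ, map_sub]; abel
        rw [e2]
        refine (norm_add_le _ _).trans (add_le_add_right ?_ _)
        exact ((A r).le_opNorm _).trans
          (mul_le_mul_of_nonneg_right (hAℓ r ⟨hr.1, hr.2.trans ht.2⟩) (norm_nonneg _))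
      rw [intervalIntegral.integral_add hi1 hi2] at h1
      have h2 : ∫ r in s..t, ‖ρ x r‖ ≤ ∫ r in Icc s T, ‖ρ x r‖ := by
        rw [intervalIntegral.integral_of_le ht.1]
        exact setIntegral_mono_set (hρi x hx).norm (Eventually.of_forall fun _ => norm_nonneg _)
          (Ioc_subset_Icc_self.trans (Icc_subset_Icc_right ht.2)).eventuallyLE
      linarith
  have hball : ∀ᶠ x in 𝓝 x₀, x ∈ Metric.closedBall x₀ 1 := Metric.closedBall_mem_nhds x₀ one_pos
  have hpt : ∀ r ∈ Icc s T, Tendsto (fun x => ‖ρ x r‖ / ‖x - x₀‖) (𝓝 x₀) (𝓝 0) := by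
    intro r hr
    have hO : (fun x => X s r x - X s r x₀) =O[𝓝 x₀] fun x => x - x₀ :=
      Asymptotics.IsBigO.of_bound (Real.exp Λ) (hball.mono fun x hx => hlip x hx r hr)
    have hc : Tendsto (fun x => X s r x) (𝓝 x₀) (𝓝 (X s r x₀)) := by
      rw [← tendsto_sub_nhds_zero_iff]
      refine hO.trans_tendsto ?_
      rw [tendsto_sub_nhds_zero_iff]
      exact tendsto_id
    have hd := ((hf.contDiff r).differentiable one_ne_zero (X s r x₀)).hasFDerivAt.isLittleO
    exact ((hd.comp_tendsto hc).trans_isBigO hO).norm_norm.tendsto_div_nhds_zero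
  have hlim : Tendsto (fun x => ∫ r in Icc s T, ‖ρ x r‖ / ‖x - x₀‖) (𝓝 x₀) (𝓝 0) := by
    have := tendsto_integral_filter_of_dominated_convergence (μ := volume.restrict (Icc s T))
      (F := fun x r => ‖ρ x r‖ / ‖x - x₀‖) (f := fun _ => (0 : ℝ)) (l := 𝓝 x₀)
      (fun r => 2 * ℓ r * Real.exp Λ)
      (Eventually.of_forall fun x => ((hρm x).norm.div_const _).aestronglyMeasurable) ?_
      ((hℓ.const_mul 2).mul_const _).integrableOn
      ((ae_restrict_iff' measurableSet_Icc).2 (Eventually.of_forall hpt))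
    · simpa using this
    · refine hball.mono fun x hx => (ae_restrict_iff' measurableSet_Icc).2
        (Eventually.of_forall fun r hr => ?_)
      rw [Real.norm_of_nonneg (by positivity)]
      have := hℓ0 r
      refine div_le_of_le_mul₀ (norm_nonneg _) (by positivity) ?_
      linarith [hρle x hx r hr]
  rw [hasFDerivAt_iff_tendsto]
  have hlim2 := hlim.const_mul (2 * Real.exp (2 * Λ))
  rw [mul_zero] at hlim2
  refine squeeze_zero' (Eventually.of_forall fun x => by positivity) (hball.mono fun x hx => ?_)
    hlim2
  rw [integral_div]
  have := mul_le_mul_of_nonneg_left (hmain x hx) (inv_nonneg.2 (norm_nonneg (x - x₀)))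
  refine this.trans (le_of_eq ?_)
  rw [div_eq_mul_inv]
  ring

end Derivative

section Liouville

variable {n : ℕ}

theorem clm_det_eq (A : E n →L[ℝ] E n) :
    A.det = (Matrix.of fun i j => A (EuclideanSpace.single j 1) i).det := by
  rw [ContinuousLinearMap.det, ← LinearMap.det_toMatrix (EuclideanSpace.basisFun (Fin n) ℝ).toBasis]
  congr 1

theorem contDiff_clm_det : ContDiff ℝ 1 fun A : E n →L[ℝ] E n => A.det := by
  simp only [clm_det_eq, Matrix.det_apply, Matrix.of_apply]
  refine ContDiff.sum fun σ _ => ContDiff.const_smul _ (contDiff_prod fun i _ => ?_)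
  exact ((EuclideanSpace.proj (σ i) : E n →L[ℝ] ℝ).comp
    (ContinuousLinearMap.apply ℝ (E n) (EuclideanSpace.single i (1 : ℝ) : E n))).contDiff

theorem clm_det_comp (A B : E n →L[ℝ] E n) : (A.comp B).det = A.det * B.det := by
  simp [ContinuousLinearMap.det]

/-- Jacobi's formula. -/
theorem fderiv_clm_det (A Z : E n →L[ℝ] E n) :
    fderiv ℝ (fun A : E n →L[ℝ] E n => A.det) Z (A.comp Z) =
      (∑ i, A (EuclideanSpace.single i 1) i) * Z.det := by
  -- Along this line the determinant is `det (1 + hA) det Z`, and `det (1 + hA) = 1 + h tr A + h²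
  -- q(h)` with `q` a polynomial.
  have h1 : HasDerivAt (fun h : ℝ => Z + h • A.comp Z) (A.comp Z) 0 := by
    simpa using ((hasDerivAt_id (0 : ℝ)).smul_const (A.comp Z)).const_add Z
  have h2 : HasFDerivAt (fun A : E n →L[ℝ] E n => A.det)
      (fderiv ℝ (fun A : E n →L[ℝ] E n => A.det) Z) (Z + (0 : ℝ) • A.comp Z) := by
    have e0 : Z + (0 : ℝ) • A.comp Z = Z := by ext x; simp
    rw [e0]
    exact ((contDiff_clm_det (n := n)).differentiable one_ne_zero _).hasFDerivAt
  have h3 := h2.comp_hasDerivAt 0 h1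
  set M : Matrix (Fin n) (Fin n) ℝ := Matrix.of fun i j => A (EuclideanSpace.single j 1) i with hM
  have e : ((fun A : E n →L[ℝ] E n => A.det) ∘ fun h : ℝ => Z + h • A.comp Z) =
      fun h : ℝ => (1 + M.trace * h + (Matrix.det
        (1 + (Polynomial.X : Polynomial ℝ) • M.map Polynomial.C)).divX.divX.eval h * h ^ 2) *
          Z.det := by
    ext h
    have e1 : Z + h • A.comp Z = (ContinuousLinearMap.id ℝ (E n) + h • A).comp Z := by
      ext x; simp
    simp only [Function.comp, e1, clm_det_comp]
    congr 1
    rw [← Matrix.det_one_add_smul, clm_det_eq]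
    congr 1
    ext i j
    simp [hM, Matrix.one_apply]
  rw [e] at h3
  have h4 : HasDerivAt (fun h : ℝ => (1 + M.trace * h + (Matrix.det
        (1 + (Polynomial.X : Polynomial ℝ) • M.map Polynomial.C)).divX.divX.eval h * h ^ 2) *
          Z.det) (M.trace * Z.det) 0 := by
    have h5 := ((hasDerivAt_id (0 : ℝ)).const_mul M.trace).const_add 1
    have h6 := (Polynomial.hasDerivAt (Matrix.det
        (1 + (Polynomial.X : Polynomial ℝ) • M.map Polynomial.C)).divX.divX (0 : ℝ)).mul
        (hasDerivAt_pow 2 (0 : ℝ))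
    simpa using (h5.add h6).mul_const Z.det
  exact h3.unique h4

/-- Liouville's formula. -/
theorem det_eq_exp_integral_trace {A Z : ℝ → E n →L[ℝ] E n} {s T : ℝ}
    (hZ : IsPrimitive Z (fun r => (A r).comp (Z r)) s T)
    (hs : Z s = ContinuousLinearMap.id ℝ (E n))
    (hA : IntervalIntegrable (fun r => ∑ i, A r (EuclideanSpace.single i 1) i) volume s T) :
    (Z T).det = Real.exp (∫ r in s..T, ∑ i, A r (EuclideanSpace.single i 1) i) := by
  have hp := hZ.prodMk (IsPrimitive.primitive hZ.le hA)
  -- By Jacobi's formula `det Z · exp (-∫ tr A)` has zero derivative, hence keeps its initial value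
  -- `1`.
  have hφ : ContDiff ℝ 1 fun p : (E n →L[ℝ] E n) × ℝ => p.1.det * Real.exp (-p.2) :=
    (contDiff_clm_det.comp contDiff_fst).mul (by fun_prop)
  have hd : ∀ p v : (E n →L[ℝ] E n) × ℝ,
      fderiv ℝ (fun p : (E n →L[ℝ] E n) × ℝ => p.1.det * Real.exp (-p.2)) p v =
        Real.exp (-p.2) * (fderiv ℝ (fun A : E n →L[ℝ] E n => A.det) p.1 v.1 -
          v.2 * p.1.det) := by
    intro p v
    have h1 : HasFDerivAt (fun p : (E n →L[ℝ] E n) × ℝ => p.1.det) _ p :=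
      (((contDiff_clm_det (n := n)).differentiable one_ne_zero p.1).hasFDerivAt).comp p
        hasFDerivAt_fst
    have h2 : HasFDerivAt (fun p : (E n →L[ℝ] E n) × ℝ => Real.exp (-p.2)) _ p :=
      hasFDerivAt_snd.neg.exp
    have h3 : HasFDerivAt
      (fun p : (E n →L[ℝ] E n) × ℝ => p.1.det * Real.exp (-p.2)) _ p := h1.mul h2
    rw [h3.fderiv]
    simp
    ring
  have h0 : ∀ r ∈ Icc s T, fderiv ℝ (fun p : (E n →L[ℝ] E n) × ℝ => p.1.det * Real.exp (-p.2))
      (Z r, ∫ r in s..r, ∑ i, A r (EuclideanSpace.single i 1) i)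
      ((A r).comp (Z r), ∑ i, A r (EuclideanSpace.single i 1) i) = 0 := by
    intro r _
    rw [hd]
    simp only [fderiv_clm_det, sub_self, mul_zero]
  have h1 := (hp.comp hφ).le_of_deriv_nonpos fun r hr => (h0 r hr).le
  have h2 := (hp.comp hφ).le_of_deriv_nonneg fun r hr => (h0 r hr).ge
  have h3 := le_antisymm h1 h2
  simp only [hs, intervalIntegral.integral_same, neg_zero, Real.exp_zero, mul_one] at h3
  have h4 : (ContinuousLinearMap.id ℝ (E n)).det = 1 := by simp [ContinuousLinearMap.det]
  rw [h4, Real.exp_neg, mul_inv_eq_iff_eq_mul₀ (Real.exp_pos _).ne', one_mul] at h3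
  exact h3

end Liouville

/-! ### Transport of the Gaussian measure -/

section Gauss

variable {n : ℕ}

theorem measurable_gaussDensity : Measurable fun x : E n =>
    ENNReal.ofReal ((2 * Real.pi) ^ (-(n : ℝ) / 2) * Real.exp (-‖x‖ ^ 2 / 2)) := by
  fun_prop

instance isFiniteMeasure_gauss : IsFiniteMeasure (gauss n) := by
  refine isFiniteMeasure_withDensity_ofReal (Integrable.hasFiniteIntegral ?_)
  refine Integrable.const_mul ?_ _
  have h := GaussianFourier.integral_rexp_neg_mul_sq_norm (V := E n) (b := 1 / 2) (by norm_num)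
  have h1 : Integrable fun v : E n => Real.exp (-(1 / 2) * ‖v‖ ^ 2) := by
    -- The Bochner integral of a non-integrable function is `0`, while the known value of the
    -- Gaussian integral is positive.
    by_contra hc
    rw [integral_undef hc] at h
    have : (0 : ℝ) < (Real.pi / (1 / 2)) ^ ((Module.finrank ℝ (E n) : ℝ) / 2) := by positivity
    exact this.ne h
  refine h1.congr (Eventually.of_forall fun x => ?_)
  simp only
  congr 1
  ring

variable {f : ℝ → E n → E n}

theorem measurable_divGauss (hf : Measurable (Function.uncurry f))
    (hd : ∀ t, Differentiable ℝ (f t)) :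
    Measurable fun p : ℝ × E n => divGauss (f p.1) p.2 := by
  have h1 := measurable_fderiv_of_contDiff hf hd
  unfold divGauss divergence
  refine Measurable.sub (Finset.measurable_sum _ fun i _ => ?_) (measurable_snd.inner hf)
  exact (EuclideanSpace.proj i : E n →L[ℝ] ℝ).continuous.measurable.comp
    (h1.apply_continuousLinearMap _)

theorem abs_clm_apply_single_le (A : E n →L[ℝ] E n) (i : Fin n) :
    |A (EuclideanSpace.single i 1) i| ≤ ‖A‖ := by
  rw [← Real.norm_eq_abs]
  refine (PiLp.norm_apply_le _ i).trans ?_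
  simpa using A.le_opNorm (EuclideanSpace.single i 1)

variable {X : ℝ → ℝ → E n → E n} {s T : ℝ}

/-- The integral of the Gaussian divergence along a trajectory. -/
noncomputable def divIntegral (f : ℝ → E n → E n) (X : ℝ → ℝ → E n → E n) (s t : ℝ) (x : E n) :
    ℝ :=
  ∫ r in s..t, divGauss (f r) (X s r x)

theorem measurable_divIntegral (hf : RegularField f)
    (hXm : Measurable (fun p : ℝ × ℝ × E n => X p.1 p.2.1 p.2.2)) (s : ℝ) :
    Measurable fun p : ℝ × E n => divIntegral f X s p.1 p.2 := by
  have hD := measurable_divGauss hf.measurable fun t => (hf.contDiff t).differentiable one_ne_zero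
  have hF : Measurable (Function.uncurry fun (p : ℝ × E n) (r : ℝ) =>
      divGauss (f r) (X s r p.2)) :=
    hD.comp (measurable_snd.prodMk (hXm.comp
      (measurable_const.prodMk (measurable_snd.prodMk measurable_fst.snd))))
  simp only [divIntegral, intervalIntegral]
  exact (measurable_setIntegral_Ioc hF measurable_const measurable_fst).sub
    (measurable_setIntegral_Ioc hF measurable_fst measurable_const)

/-- The Jacobian of the flow, relative to the Gaussian density. -/
theorem RegularField.exists_hasFDerivAt_det (hf : RegularField f)
    (hXm : Measurable (fun p : ℝ × ℝ × E n => X p.1 p.2.1 p.2.2)) (hsT : s ≤ T)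
    (hX : ∀ x, IsSol f s T x (fun t => X s t x)) (x : E n) :
    IntervalIntegrable (fun r => divGauss (f r) (X s r x)) volume s T ∧
    ∃ L : E n →L[ℝ] E n, HasFDerivAt (X s T) L x ∧
      |L.det| * Real.exp (-‖X s T x‖ ^ 2 / 2) =
        Real.exp (divIntegral f X s T x) * Real.exp (-‖x‖ ^ 2 / 2) := by
  obtain ⟨Z, hZ, hZs, hZT⟩ := hf.hasFDerivAt_flow hXm hsT hX x
  obtain ⟨R, ℓ, hℓ, hℓ0, hℓf, hb⟩ := hf.exists_lipschitz_rate x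
  have hXc : Measurable fun r => X s r x :=
    hXm.comp (measurable_const.prodMk (measurable_id.prodMk measurable_const))
  have hA : Measurable fun r => fderiv ℝ (f r) (X s r x) :=
    (measurable_fderiv_of_contDiff hf.measurable
      fun t => (hf.contDiff t).differentiable one_ne_zero).comp (measurable_id.prodMk hXc)
  have hdiv : IntervalIntegrable (fun r => divergence (f r) (X s r x)) volume s T := by
    rw [intervalIntegrable_iff_integrableOn_Icc_of_le hsT]
    unfold divergence
    refine integrable_finsetSum _ fun i _ => ?_
    refine Integrable.mono' hℓ.integrableOn
      ((EuclideanSpace.proj i : E n →L[ℝ] ℝ).continuous.measurable.comp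
        (hA.apply_continuousLinearMap _)).aestronglyMeasurable
      ((ae_restrict_iff' measurableSet_Icc).2 (Eventually.of_forall fun r hr => ?_))
    exact (abs_clm_apply_single_le _ i).trans (hℓf r _
      (hb x (Metric.mem_closedBall_self zero_le_one) s T _ (hX x) r hr))
  -- The change of `|X|²/2` is the integral of `X · f`. Subtracting it in the exponent turns the
  -- divergence of Liouville's formula into the Gaussian divergence.
  have hnorm := ((hX x).isPrimitive hsT).comp (contDiff_norm_sq ℝ (E := E n) (n := 1))
  have hfd : ∀ y v : E n, fderiv ℝ (fun x : E n => ‖x‖ ^ 2) y v = 2 * inner ℝ y v := by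
    intro y v
    rw [(hasStrictFDerivAt_norm_sq y).hasFDerivAt.fderiv]
    simp
  simp only [hfd] at hnorm
  have hin : IntervalIntegrable (fun r => inner ℝ (X s r x) (f r (X s r x))) volume s T := by
    have := hnorm.integrable.const_mul (1 / 2)
    simpa using this
  have hs : X s s x = x := (hX x).init hsT
  have h1 := hnorm.eq T ⟨hsT, le_rfl⟩
  rw [hs, intervalIntegral.integral_const_mul] at h1
  refine ⟨hdiv.sub hin, Z T, hZT, ?_⟩
  have h2 : (Z T).det = Real.exp (∫ r in s..T, divergence (f r) (X s r x)) :=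
    det_eq_exp_integral_trace hZ hZs hdiv
  have h3 : divIntegral f X s T x = (∫ r in s..T, divergence (f r) (X s r x)) -
      ∫ r in s..T, inner ℝ (X s r x) (f r (X s r x)) :=
    intervalIntegral.integral_sub hdiv hin
  rw [h2, h3, abs_of_pos (Real.exp_pos _), ← Real.exp_add, ← Real.exp_add, h1]
  congr 1
  ring

theorem RegularField.injective_flow (hf : RegularField f) (hsT : s ≤ T)
    (hX : ∀ x, IsSol f s T x (fun t => X s t x)) : Function.Injective (X s T) := fun x x' h =>
  hf.eq_of_eq_at_end (hX x) (hX x') hsT h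

/-- A continuous injection of a Polish space has Borel images of Borel sets (Lusin–Souslin). This
makes the range measurable, so surjectivity is not needed. -/
theorem RegularField.measurableEmbedding_flow (hf : RegularField f)
    (hXm : Measurable (fun p : ℝ × ℝ × E n => X p.1 p.2.1 p.2.2)) (hsT : s ≤ T)
    (hX : ∀ x, IsSol f s T x (fun t => X s t x)) : MeasurableEmbedding (X s T) := by
  refine Continuous.measurableEmbedding (continuous_iff_continuousAt.2 fun x => ?_)
    (hf.injective_flow hsT hX)
  obtain ⟨-, L, hL, -⟩ := hf.exists_hasFDerivAt_det hXm hsT hX x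
  exact hL.continuousAt

/-- Change of variables along the flow. -/
theorem RegularField.lintegral_comp_flow (hf : RegularField f)
    (hXm : Measurable (fun p : ℝ × ℝ × E n => X p.1 p.2.1 p.2.2)) (hsT : s ≤ T)
    (hX : ∀ x, IsSol f s T x (fun t => X s t x)) {F : E n → ℝ≥0∞} (hF : Measurable F) :
    ∫⁻ x, ENNReal.ofReal (Real.exp (divIntegral f X s T x)) * F (X s T x) ∂(gauss n) =
      ∫⁻ y in range (X s T), F y ∂(gauss n) := by
  choose hint L hL hdet using fun x => hf.exists_hasFDerivAt_det hXm hsT hX x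
  have he := hf.measurableEmbedding_flow hXm hsT hX
  have hI : Measurable fun x => divIntegral f X s T x :=
    (measurable_divIntegral hf hXm s).comp (measurable_const.prodMk measurable_id)
  have hm : Measurable fun x =>
      ENNReal.ofReal (Real.exp (divIntegral f X s T x)) * F (X s T x) :=
    hI.exp.ennreal_ofReal.mul (hF.comp he.measurable)
  rw [gauss, restrict_withDensity he.measurableSet_range,
    lintegral_withDensity_eq_lintegral_mul _ measurable_gaussDensity hF,
    lintegral_withDensity_eq_lintegral_mul _ measurable_gaussDensity hm, ← image_univ,
    lintegral_image_eq_lintegral_abs_det_fderiv_mul volume MeasurableSet.univ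
      (fun x _ => (hL x).hasFDerivWithinAt) he.injective.injOn, Measure.restrict_univ]
  refine lintegral_congr fun x => ?_
  simp only [Pi.mul_apply]
  rw [← mul_assoc, ← mul_assoc, ← ENNReal.ofReal_mul (by positivity),
    ← ENNReal.ofReal_mul (by positivity)]
  congr 2
  linear_combination (-(2 * Real.pi) ^ (-(n : ℝ) / 2)) * hdet x

theorem RegularField.lintegral_comp_flow_le (hf : RegularField f)
    (hXm : Measurable (fun p : ℝ × ℝ × E n => X p.1 p.2.1 p.2.2)) (hsT : s ≤ T)
    (hX : ∀ x, IsSol f s T x (fun t => X s t x)) {F : E n → ℝ≥0∞} (hF : Measurable F) :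
    ∫⁻ x, ENNReal.ofReal (Real.exp (divIntegral f X s T x)) * F (X s T x) ∂(gauss n) ≤
      ∫⁻ y, F y ∂(gauss n) := by
  rw [hf.lintegral_comp_flow hXm hsT hX hF]
  exact setLIntegral_le_lintegral _ _

/-- The image of the Gaussian measure under the flow has a density, explicit along the flow. -/
theorem RegularField.density_flow (hf : RegularField f)
    (hXm : Measurable (fun p : ℝ × ℝ × E n => X p.1 p.2.1 p.2.2)) (hsT : s ≤ T)
    (hX : ∀ x, IsSol f s T x (fun t => X s t x)) :
    (gauss n).map (X s T) ≪ gauss n ∧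
      ∀ᵐ x ∂(gauss n), density X s T (X s T x) = Real.exp (-divIntegral f X s T x) := by
  have he := hf.measurableEmbedding_flow hXm hsT hX
  have hI : Measurable fun x => divIntegral f X s T x :=
    (measurable_divIntegral hf hXm s).comp (measurable_const.prodMk measurable_id)
  -- The density must be `exp (-I) ∘ X⁻¹` on the range and `0` off it; `k` is a Borel extension of
  -- the first expression.
  obtain ⟨k, hk, hkX⟩ := he.exists_measurable_extend
    (g := fun x => Real.exp (-divIntegral f X s T x)) hI.neg.exp fun _ => ⟨0⟩
  have hkX' : ∀ x, k (X s T x) = Real.exp (-divIntegral f X s T x) := congrFun hkX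
  set K : E n → ℝ≥0∞ := (range (X s T)).indicator fun y => ENNReal.ofReal (k y) with hK
  have hKm : Measurable K := hk.ennreal_ofReal.indicator he.measurableSet_range
  have hν : (gauss n).map (X s T) = (gauss n).withDensity K := by
    ext B hB
    have hF : Measurable fun y => ENNReal.ofReal (k y) * B.indicator 1 y :=
      hk.ennreal_ofReal.mul (measurable_one.indicator hB)
    rw [← lintegral_indicator_one hB, lintegral_map (measurable_one.indicator hB) he.measurable,
      withDensity_apply _ hB, hK, setLIntegral_indicator he.measurableSet_range]
    have h1 := hf.lintegral_comp_flow hXm hsT hX hF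
    have h2 : ∫⁻ y in range (X s T), ENNReal.ofReal (k y) * B.indicator 1 y ∂(gauss n) =
        ∫⁻ y in range (X s T) ∩ B, ENNReal.ofReal (k y) ∂(gauss n) := by
      rw [inter_comm, ← setLIntegral_indicator hB]
      refine lintegral_congr fun y => ?_
      by_cases hy : y ∈ B <;> simp [hy]
    rw [← h2, ← h1]
    refine lintegral_congr fun x => ?_
    rw [hkX', ← mul_assoc, ← ENNReal.ofReal_mul (Real.exp_pos _).le, ← Real.exp_add]
    simp
  have hac : (gauss n).map (X s T) ≪ gauss n := by
    rw [hν]; exact withDensity_absolutelyContinuous _ _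
  refine ⟨hac, ?_⟩
  have h1 : ((gauss n).map (X s T)).rnDeriv (gauss n) =ᵐ[gauss n] K := by
    rw [hν]; exact Measure.rnDeriv_withDensity _ hKm
  filter_upwards [ae_of_ae_map he.measurable.aemeasurable (hac.ae_eq h1)] with x hx
  rw [density, hx, hK, indicator_of_mem (mem_range_self x), hkX',
    ENNReal.toReal_ofReal (Real.exp_pos _).le]

/-- Integrals of the density are integrals along the flow. -/
theorem RegularField.lintegral_density (hf : RegularField f)
    (hXm : Measurable (fun p : ℝ × ℝ × E n => X p.1 p.2.1 p.2.2)) (hsT : s ≤ T)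
    (hX : ∀ x, IsSol f s T x (fun t => X s t x)) {φ : ℝ → ℝ} (hφ : Measurable φ)  :
    ∫⁻ y, ENNReal.ofReal (density X s T y * φ (density X s T y)) ∂(gauss n) =
      ∫⁻ x, ENNReal.ofReal (φ (Real.exp (-divIntegral f X s T x))) ∂(gauss n) := by
  obtain ⟨hac, hd⟩ := hf.density_flow hXm hsT hX
  have hm : Measurable (X s T) := (hf.measurableEmbedding_flow hXm hsT hX).measurable
  have hdm : Measurable (density X s T) := (Measure.measurable_rnDeriv _ _).ennreal_toReal
  have : IsFiniteMeasure ((gauss n).map (X s T)) := Measure.isFiniteMeasure_map _ _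
  have : ((gauss n).map (X s T)).HaveLebesgueDecomposition (gauss n) :=
    Measure.haveLebesgueDecomposition_of_sigmaFinite _ _
  calc ∫⁻ y, ENNReal.ofReal (density X s T y * φ (density X s T y)) ∂(gauss n)
      = ∫⁻ y, ((gauss n).map (X s T)).rnDeriv (gauss n) y *
          ENNReal.ofReal (φ (density X s T y)) ∂(gauss n) := by
        refine lintegral_congr_ae ?_
        filter_upwards [Measure.rnDeriv_lt_top ((gauss n).map (X s T)) (gauss n)] with y hy
        have h0 : 0 ≤ density X s T y := ENNReal.toReal_nonneg
        rw [ENNReal.ofReal_mul h0]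
        congr 1
        exact ENNReal.ofReal_toReal hy.ne
    _ = ∫⁻ y, ENNReal.ofReal (φ (density X s T y)) ∂((gauss n).map (X s T)) :=
        lintegral_rnDeriv_mul hac (hφ.comp hdm).ennreal_ofReal.aemeasurable
    _ = ∫⁻ x, ENNReal.ofReal (φ (density X s T (X s T x))) ∂(gauss n) :=
        lintegral_map (hφ.comp hdm).ennreal_ofReal hm
    _ = _ := by
        refine lintegral_congr_ae ?_
        filter_upwards [hd] with x hx
        rw [hx]

end Gauss

/-! ### The exponential moment of the divergence along the flow -/

/-- The constant of the Young-type inequality `mul_exp_le_of_lt`. -/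
noncomputable def youngConst : ℝ := 128 * Real.exp 2048

theorem youngConst_pos : 0 < youngConst := by unfold youngConst; positivity

/-- A Young-type inequality: if `w` dominates `M log M`, then `w exp (2 M)` is controlled by the
Orlicz function of `Exp (L / log L)`. -/
theorem mul_exp_le_of_lt {M w : ℝ} (hM : 1 ≤ M) (h : 16 * (M * Real.log M) < w) :
    w * Real.exp (2 * M) ≤ youngConst * Real.exp (w / logPlus w) := by
  have hlogM : 0 ≤ Real.log M := Real.log_nonneg hM
  have hw0 : 0 < w := lt_of_le_of_lt (by positivity) h
  -- For `w < e` the hypothesis bounds `M`, because `M - 1 ≤ M log M`; everything is then absorbed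
  -- by the constant.
  rcases lt_or_ge w (Real.exp 1) with hwe | hwe
  · have h1 : M - 1 ≤ M * Real.log M := by
      have := Real.one_sub_inv_le_log_of_pos (zero_lt_one.trans_le hM)
      have h2 := mul_le_mul_of_nonneg_left this (zero_le_one.trans hM)
      rwa [mul_sub, mul_one, mul_inv_cancel₀ (by positivity)] at h2
    have h2 : Real.exp 1 < 3 := by have := Real.exp_one_lt_d9; linarith
    have h3 : Real.exp (2 * M) ≤ Real.exp 2048 := Real.exp_le_exp.2 (by linarith)
    have h4 : 1 ≤ Real.exp (w / logPlus w) := Real.one_le_exp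
      (div_nonneg hw0.le (zero_le_one.trans (one_le_logPlus w)))
    calc w * Real.exp (2 * M) ≤ 128 * Real.exp 2048 :=
          mul_le_mul (by linarith) h3 (Real.exp_pos _).le (by norm_num)
      _ ≤ _ := le_mul_of_one_le_right youngConst_pos.le h4
  have hlog1 : 1 ≤ Real.log w := by rwa [Real.le_log_iff_exp_le hw0]
  have hlp : logPlus w = Real.log w := max_eq_right hlog1
  have he1 : 1 ≤ Real.exp 1 := Real.one_le_exp zero_le_one
  -- With `y = w^(1/4)` and `H = w / log w`, the bound `log w ≤ 4y` gives `H ≥ y³/4`. Half of `H`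
  -- pays for the prefactor `w`, since `exp (y³/8) ≥ y⁶/128`, and a quarter pays for `exp (2M)`.
  obtain ⟨y, hy1, rfl⟩ : ∃ y : ℝ, 1 ≤ y ∧ w = y ^ 4 := by
    refine ⟨√(√w), ?_, ?_⟩
    · rw [Real.one_le_sqrt, Real.one_le_sqrt]; linarith
    · rw [show (4 : ℕ) = 2 * 2 from rfl, pow_mul, Real.sq_sqrt (Real.sqrt_nonneg _),
        Real.sq_sqrt hw0.le]
  have hy0 : 0 < y := zero_lt_one.trans_le hy1
  rw [hlp]
  set H := y ^ 4 / Real.log (y ^ 4) with hH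
  have hlog : Real.log (y ^ 4) ≤ 4 * y := by
    rw [Real.log_pow]
    have := Real.log_le_sub_one_of_pos hy0
    push_cast
    linarith
  have hH1 : y ^ 3 / 4 ≤ H := by
    rw [hH, le_div_iff₀ (by linarith)]
    have := mul_le_mul_of_nonneg_left hlog (by positivity : 0 ≤ y ^ 3 / 4)
    nlinarith
  have hy4 : y ^ 4 ≤ 128 * Real.exp (H / 2) := by
    have h1 : y ^ 3 / 8 ≤ H / 2 := by linarith
    have h2 := Real.quadratic_le_exp_of_nonneg (by positivity : 0 ≤ y ^ 3 / 8)
    have h3 := Real.exp_le_exp.2 h1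
    have h4 : y ^ 4 ≤ y ^ 6 := pow_le_pow_right₀ hy1 (by norm_num)
    have h5 : (y ^ 3) ^ 2 = y ^ 6 := by ring
    nlinarith [pow_pos hy0 3]
  have h2M : 2 * M ≤ 2048 + H / 4 := by
    -- If `M ≥ √w`, then `log w ≤ 2 log M` and `w > 16 M log M` give `8M ≤ H`. Otherwise `2M < 2y²`,
    -- which is at most `2048` for `y ≤ 32` and at most `y³/16` beyond.
    rcases le_or_gt (y ^ 2) M with hc | hc
    · have h1 : Real.log (y ^ 4) ≤ 2 * Real.log M := by
        have := Real.log_le_log (by positivity) hc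
        rw [Real.log_pow] at this ⊢
        push_cast at this ⊢
        linarith
      have h2 : 8 * M ≤ H := by
        rw [hH, le_div_iff₀ (by linarith)]
        have := mul_le_mul_of_nonneg_left h1 (by positivity : 0 ≤ 8 * M)
        linarith
      linarith
    · have h1 : 2 * y ^ 2 ≤ 2048 + y ^ 3 / 16 := by
        rcases le_or_gt y 32 with h32 | h32
        · nlinarith [pow_pos hy0 3]
        · nlinarith [pow_pos hy0 2]
      linarith
  calc y ^ 4 * Real.exp (2 * M) ≤ 128 * Real.exp (H / 2) * Real.exp (2048 + H / 4) :=
        mul_le_mul hy4 (Real.exp_le_exp.2 h2M) (Real.exp_pos _).le (by positivity)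
    _ = youngConst * Real.exp (H / 2 + H / 4) := by
        rw [youngConst, Real.exp_add, Real.exp_add]; ring
    _ ≤ _ := by
        have : 0 ≤ H := le_trans (by positivity) hH1
        have h0 := youngConst_pos
        gcongr
        linarith

/-- `exp (M ^ a)` with `M = (1 + I²)^(1/2)` and `a = exp (-16 λ)`, as a function of `(I, λ)`. -/
noncomputable def expPotential (p : ℝ × ℝ) : ℝ :=
  Real.exp (Real.exp (Real.exp (-16 * p.2) * (Real.log (1 + p.1 ^ 2) / 2)))

theorem contDiff_expPotential : ContDiff ℝ 1 expPotential := by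
  unfold expPotential
  have h : ContDiff ℝ 1 fun p : ℝ × ℝ => Real.log (1 + p.1 ^ 2) :=
    ContDiff.log (by fun_prop) fun p => by positivity
  fun_prop

/-- The pointwise inequality behind the theorem. The decay `-16 B log M` from the shrinking exponent
beats the growth of `M` unless `|d| / B` exceeds `16 M log M`, and then `mul_exp_le_of_lt` applies.
The factor `exp I` is kept on the right because it is the Jacobian of the flow. -/
theorem fderiv_expPotential_le {I lam d B : ℝ} (hlam : 0 ≤ lam) (hB : 0 < B) :
    fderiv ℝ expPotential (I, lam) (d, B) ≤
      Real.exp I * (youngConst * B * Real.exp (|d| / B / logPlus (|d| / B))) := by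
  set M := Real.exp (Real.log (1 + I ^ 2) / 2) with hM
  set m := Real.log (1 + I ^ 2) / 2 with hm
  set a := Real.exp (-16 * lam) with ha
  have hp : 0 < 1 + I ^ 2 := by positivity
  have hM2 : M ^ 2 = 1 + I ^ 2 := by
    rw [hM, ← Real.exp_nat_mul, hm]
    push_cast
    rw [mul_div_cancel₀ _ two_ne_zero, Real.exp_log hp]
  have hm0 : 0 ≤ m := div_nonneg (Real.log_nonneg (by nlinarith [sq_nonneg I])) zero_le_two
  have hM1 : 1 ≤ M := Real.one_le_exp hm0
  have ha0 : 0 < a := Real.exp_pos _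
  have ha1 : a ≤ 1 := Real.exp_le_one_iff.2 (by linarith)
  have hIM : |I| ≤ M := abs_le_of_sq_le_sq (by linarith) (by linarith)
  have hder : fderiv ℝ expPotential (I, lam) (d, B) =
      Real.exp (Real.exp (a * m)) * Real.exp (a * m) * a * (-16 * B * m + I * d / M ^ 2) := by
    have h1 : HasFDerivAt (fun p : ℝ × ℝ => p.1) (ContinuousLinearMap.fst ℝ ℝ ℝ) (I, lam) :=
      hasFDerivAt_fst
    have h2 : HasFDerivAt (fun p : ℝ × ℝ => p.2) (ContinuousLinearMap.snd ℝ ℝ ℝ) (I, lam) :=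
      hasFDerivAt_snd
    have h3 := ((h1.pow 2).const_add 1).log hp.ne'
    have h4 := (h2.const_mul (-16)).exp
    have h5 : HasFDerivAt expPotential _ (I, lam) :=
      ((h4.mul (h3.mul_const (1 / 2))).exp.exp).congr_of_eventuallyEq
        (Eventually.of_forall fun p => by simp [expPotential, div_eq_mul_inv])
    rw [h5.fderiv, hM2]
    simp [ha, hm, ← div_eq_mul_inv]
    field_simp
    ring
  have hE : Real.exp (a * m) ≤ M := Real.exp_le_exp.2 (mul_le_of_le_one_left hm0 ha1)
  set w := |d| / B with hw
  have hdw : |d| = B * w := by rw [hw]; field_simp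
  have hR : 0 ≤ Real.exp I * (youngConst * B * Real.exp (w / logPlus w)) := by
    have := youngConst_pos
    positivity
  have hId : I * d / M ^ 2 ≤ B * w / M := by
    rw [div_le_div_iff₀ (by positivity) (by positivity), ← hdw]
    have h1 : I * d ≤ M * |d| := (le_abs_self _).trans (by
      rw [abs_mul]; exact mul_le_mul_of_nonneg_right hIM (abs_nonneg _))
    nlinarith [mul_le_mul_of_nonneg_right h1 (by positivity : 0 ≤ M)]
  rw [hder]
  rcases le_or_gt w (16 * (M * m)) with hc | hc
  · refine le_trans (mul_nonpos_of_nonneg_of_nonpos (by positivity) ?_) hR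
    have : B * w / M ≤ 16 * B * m := by
      rw [div_le_iff₀ (by positivity)]
      nlinarith [mul_le_mul_of_nonneg_left hc hB.le]
    linarith
  · have hlogM : Real.log M = m := Real.log_exp _
    have hy := mul_exp_le_of_lt hM1 (by rw [hlogM]; exact hc)
    have hw0 : 0 < w := lt_of_le_of_lt (by positivity) hc
    have h1 : -16 * B * m + I * d / M ^ 2 ≤ B * w / M := by
      have : 0 ≤ B * m := by positivity
      linarith
    -- `M^a ≤ M` as `a ≤ 1`, and `M ≤ I + 2M` as `|I| ≤ M`.
    have h2 : Real.exp (Real.exp (a * m)) ≤ Real.exp I * Real.exp (2 * M) := by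
      rw [← Real.exp_add]
      refine Real.exp_le_exp.2 ?_
      have := neg_abs_le I
      linarith
    calc Real.exp (Real.exp (a * m)) * Real.exp (a * m) * a * (-16 * B * m + I * d / M ^ 2)
        ≤ Real.exp (Real.exp (a * m)) * Real.exp (a * m) * a * (B * w / M) :=
          mul_le_mul_of_nonneg_left h1 (by positivity)
      _ ≤ (Real.exp I * Real.exp (2 * M)) * M * 1 * (B * w / M) := by gcongr
      _ = Real.exp I * (B * (w * Real.exp (2 * M))) := by field_simp
      _ ≤ Real.exp I * (B * (youngConst * Real.exp (w / logPlus w))) := by gcongr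
      _ = _ := by ring

/-- `log⁺ (exp (-I)) = max (1, -I) ≤ (1 + I²)^(1/2) = M`, and `M ≥ 1` allows the exponent `α` to be
raised to `exp (-16 λ)`. -/
theorem exp_logPlus_rpow_le {α I lam : ℝ} (hα : 0 < α) (h : α ≤ Real.exp (-16 * lam)) :
    Real.exp (logPlus (Real.exp (-I)) ^ α) ≤ expPotential (I, lam) := by
  have hp : 0 < 1 + I ^ 2 := by positivity
  set m := Real.log (1 + I ^ 2) / 2 with hm
  have hm0 : 0 ≤ m := div_nonneg (Real.log_nonneg (by nlinarith [sq_nonneg I])) zero_le_two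
  have hM2 : Real.exp m ^ 2 = 1 + I ^ 2 := by
    rw [← Real.exp_nat_mul, hm]
    push_cast
    rw [mul_div_cancel₀ _ two_ne_zero, Real.exp_log hp]
  have h1 : logPlus (Real.exp (-I)) ≤ Real.exp m := by
    rw [logPlus, Real.log_exp]
    refine max_le (Real.one_le_exp hm0) ((neg_le_abs I).trans ?_)
    exact abs_le_of_sq_le_sq (by linarith) (Real.exp_pos _).le
  refine Real.exp_le_exp.2 ?_
  calc logPlus (Real.exp (-I)) ^ α ≤ Real.exp m ^ α :=
        Real.rpow_le_rpow (zero_le_one.trans (one_le_logPlus _)) h1 hα.le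
    _ = Real.exp (m * α) := (Real.exp_mul _ _).symm
    _ ≤ _ := Real.exp_le_exp.2 (by
        simp only
        rw [mul_comm]
        exact mul_le_mul_of_nonneg_right h hm0)

theorem ofReal_integral_le_lintegral {α : Type*} [MeasurableSpace α] {μ : Measure α} {g : α → ℝ}
    (hg : Integrable g μ) : ENNReal.ofReal (∫ x, g x ∂μ) ≤ ∫⁻ x, ENNReal.ofReal (g x) ∂μ := by
  rw [integral_eq_lintegral_pos_part_sub_lintegral_neg_part hg]
  refine (ENNReal.ofReal_le_ofReal (sub_le_self _ ENNReal.toReal_nonneg)).trans ?_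
  exact ENNReal.ofReal_toReal_le

section Main

variable {n : ℕ} {f : ℝ → E n → E n} {X : ℝ → ℝ → E n → E n} {s T : ℝ}

/-- The derivative bound is integrated in time along each trajectory, then in space. After Tonelli,
the change of variables at each intermediate time `r` replaces the integral along the flow by one of
the Orlicz function against `μ`. The term with `exp 1` is the initial value `expPotential (0, 0)`.
-/
theorem RegularField.lintegral_expPotential_le (hf : RegularField f)
    (hXm : Measurable (fun p : ℝ × ℝ × E n => X p.1 p.2.1 p.2.2)) (hsT : s ≤ T)
    (hX : ∀ x, IsSol f s T x (fun t => X s t x)) {B : ℝ → ℝ} (hBm : Measurable B)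
    (hB0 : ∀ r, 0 < B r) (hBi : IntegrableOn B (Icc s T))
    (hBD : ∀ᵐ r ∂(volume.restrict (Icc s T)),
      ∫⁻ x, ENNReal.ofReal (expLLog (|divGauss (f r) x| / B r)) ∂(gauss n) ≤ 1) :
    ∫⁻ x, ENNReal.ofReal (expPotential (divIntegral f X s T x, ∫ r in s..T, B r)) ∂(gauss n) ≤
      ENNReal.ofReal (Real.exp 1) * gauss n univ +
        ENNReal.ofReal youngConst * (1 + gauss n univ) *
          ∫⁻ r in Icc s T, ENNReal.ofReal (B r) := by
  have hD := measurable_divGauss hf.measurable fun t => (hf.contDiff t).differentiable one_ne_zero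
  have hBi' : IntervalIntegrable B volume s T :=
    (intervalIntegrable_iff_integrableOn_Icc_of_le hsT).2 hBi
  set F : ℝ → E n → ℝ≥0∞ := fun r y => ENNReal.ofReal
    (youngConst * B r * Real.exp (|divGauss (f r) y| / B r / logPlus (|divGauss (f r) y| / B r)))
    with hF
  have hFm : Measurable (Function.uncurry F) := by
    have h1 : Measurable fun p : ℝ × E n => |divGauss (f p.1) p.2| / B p.1 := by
      have h2 : Measurable fun p : ℝ × E n => |divGauss (f p.1) p.2| :=
        continuous_abs.measurable.comp hD
      exact h2.div (hBm.comp measurable_fst)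
    exact (((hBm.comp measurable_fst).const_mul _).mul
      (h1.div (measurable_logPlus.comp h1)).exp).ennreal_ofReal
  have hIm := measurable_divIntegral hf hXm s
  set G : E n → ℝ → ℝ≥0∞ := fun x r =>
    ENNReal.ofReal (Real.exp (divIntegral f X s r x)) * F r (X s r x) with hG
  have hGm : Measurable (Function.uncurry G) := by
    have h1 : Measurable fun p : E n × ℝ => divIntegral f X s p.2 p.1 :=
      hIm.comp (measurable_snd.prodMk measurable_fst)
    exact h1.exp.ennreal_ofReal.mul (hFm.comp (measurable_snd.prodMk (hXm.comp
      (measurable_const.prodMk (measurable_snd.prodMk measurable_fst)))))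
  have hpt : ∀ x, ENNReal.ofReal (expPotential (divIntegral f X s T x, ∫ r in s..T, B r)) ≤
      ENNReal.ofReal (Real.exp 1) + ∫⁻ r in Icc s T, G x r := by
    intro x
    obtain ⟨hint, -⟩ := hf.exists_hasFDerivAt_det hXm hsT hX x
    have hp := ((IsPrimitive.primitive hsT hint).prodMk
      (IsPrimitive.primitive hsT hBi')).comp contDiff_expPotential
    have h1 := hp.eq T ⟨hsT, le_rfl⟩
    have h0 : expPotential (0, 0) = Real.exp 1 := by simp [expPotential]
    simp only [intervalIntegral.integral_same, h0] at h1
    change expPotential (divIntegral f X s T x, ∫ r in s..T, B r) = _ at h1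
    rw [h1]
    refine ENNReal.ofReal_add_le.trans (add_le_add_right ?_ _)
    rw [intervalIntegral.integral_of_le hsT, ← integral_Icc_eq_integral_Ioc]
    refine (ofReal_integral_le_lintegral
      ((intervalIntegrable_iff_integrableOn_Icc_of_le hsT).1 hp.integrable)).trans ?_
    refine setLIntegral_mono' measurableSet_Icc fun r hr => ?_
    have hlam : 0 ≤ ∫ q in s..r, B q :=
      intervalIntegral.integral_nonneg hr.1 fun q _ => (hB0 q).le
    have h2 := fderiv_expPotential_le (I := divIntegral f X s r x)
      (d := divGauss (f r) (X s r x)) hlam (hB0 r)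
    rw [hG, hF]
    simp only
    rw [← ENNReal.ofReal_mul (Real.exp_pos _).le]
    exact ENNReal.ofReal_le_ofReal h2
  have hFle : ∀ᵐ r ∂(volume.restrict (Icc s T)), ∫⁻ x, G x r ∂(gauss n) ≤
      ENNReal.ofReal youngConst * (1 + gauss n univ) * ENNReal.ofReal (B r) := by
    filter_upwards [hBD, ae_restrict_mem measurableSet_Icc] with r hr hrm
    refine (hf.lintegral_comp_flow_le hXm hrm.1 (fun x => (hX x).mono hrm.2)
      (F := F r) (hFm.comp (measurable_const.prodMk measurable_id))).trans ?_
    have hY := youngConst_pos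
    have h1 : ∀ y, F r y ≤ ENNReal.ofReal (youngConst * B r) *
        (ENNReal.ofReal (expLLog (|divGauss (f r) y| / B r)) + 1) := by
      intro y
      have hBr := hB0 r
      rw [hF]
      simp only
      rw [ENNReal.ofReal_mul (by positivity)]
      gcongr
      rw [expLLog, ← ENNReal.ofReal_one]
      refine le_trans (ENNReal.ofReal_le_ofReal ?_) ENNReal.ofReal_add_le
      linarith
    refine (lintegral_mono h1).trans ?_
    rw [lintegral_const_mul' _ _ ENNReal.ofReal_ne_top, lintegral_add_right _ measurable_const,
      lintegral_one, ENNReal.ofReal_mul hY.le]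
    calc _ ≤ ENNReal.ofReal youngConst * ENNReal.ofReal (B r) * (1 + gauss n univ) := by gcongr
      _ = _ := by ring
  calc _ ≤ ∫⁻ x, (ENNReal.ofReal (Real.exp 1) + (∫⁻ r in Icc s T, G x r)) ∂(gauss n) :=
        lintegral_mono hpt
    _ = ENNReal.ofReal (Real.exp 1) * gauss n univ +
        ∫⁻ x, (∫⁻ r in Icc s T, G x r) ∂(gauss n) := by
        rw [lintegral_add_left measurable_const, lintegral_const]
    _ = ENNReal.ofReal (Real.exp 1) * gauss n univ +
        ∫⁻ r in Icc s T, (∫⁻ x, G x r ∂(gauss n)) := by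
        rw [lintegral_lintegral_swap hGm.aemeasurable]
    _ ≤ ENNReal.ofReal (Real.exp 1) * gauss n univ +
        ∫⁻ r in Icc s T, ENNReal.ofReal youngConst * (1 + gauss n univ) *
          ENNReal.ofReal (B r) := by
        gcongr 1
        exact lintegral_mono_ae hFle
    _ = _ := by
        rw [lintegral_const_mul _ hBm.ennreal_ofReal]

end Main

/-! ### Orlicz norms -/

/-- `log t / t` decreases beyond `e`, which is exactly where `log⁺` changes from `1` to `log`. -/
theorem div_logPlus_mono {x y : ℝ} (hx : 0 ≤ x) (hxy : x ≤ y) :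
    x / logPlus x ≤ y / logPlus y := by
  have h1 : ∀ z, 0 < logPlus z := fun z => zero_lt_one.trans_le (one_le_logPlus z)
  have hsmall : ∀ z, 0 ≤ z → z < Real.exp 1 → logPlus z = 1 := fun z hz hze => by
    refine max_eq_left ?_
    rcases hz.eq_or_lt with rfl | hz
    · simp
    · exact ((Real.log_lt_iff_lt_exp hz).2 hze).le
  have hlarge : ∀ z, Real.exp 1 ≤ z → logPlus z = Real.log z := fun z hz =>
    max_eq_right ((Real.le_log_iff_exp_le ((Real.exp_pos 1).trans_le hz)).2 hz)
  rw [div_le_div_iff₀ (h1 _) (h1 _)]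
  rcases lt_or_ge y (Real.exp 1) with hy | hy
  · rw [hsmall x hx (hxy.trans_lt hy), hsmall y (hx.trans hxy) hy]
    linarith
  have hy0 : 0 < y := (Real.exp_pos 1).trans_le hy
  have hanti := Real.log_div_self_antitoneOn
  rw [hlarge y hy]
  rcases lt_or_ge x (Real.exp 1) with hxe | hxe
  · have := hanti (mem_ofPred_eq ▸ le_refl (Real.exp 1)) hy hy
    simp only [Real.log_exp] at this
    rw [div_le_div_iff₀ hy0 (Real.exp_pos 1)] at this
    have hl : 0 ≤ Real.log y := zero_le_one.trans ((Real.le_log_iff_exp_le hy0).2 hy)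
    rw [hsmall x hx hxe]
    nlinarith
  · have := hanti hxe hy hxy
    simp only at this
    rw [div_le_div_iff₀ hy0 ((Real.exp_pos 1).trans_le hxe)] at this
    rw [hlarge x hxe]
    linarith

theorem expLLog_mono {x y : ℝ} (hx : 0 ≤ x) (hxy : x ≤ y) : expLLog x ≤ expLLog y := by
  unfold expLLog
  have := div_logPlus_mono hx hxy
  gcongr

theorem measurable_expLLog : Measurable expLLog :=
  (measurable_id.div measurable_logPlus).exp.sub_const 1

section LuxNorm

variable {Ω : Type*} [MeasurableSpace Ω] {μ : Measure Ω} {u : Ω → ℝ}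

theorem exists_of_luxNorm_lt {P : ℝ → ℝ} {c : ℝ≥0∞} (h : luxNorm P μ u < c) :
    ∃ l : ℝ, 0 < l ∧ ENNReal.ofReal l < c ∧ ∫⁻ x, ENNReal.ofReal (P (|u x| / l)) ∂μ ≤ 1 := by
  obtain ⟨_, ⟨l, hl, rfl, hle⟩, hlc⟩ := sInf_lt_iff.1 h
  exact ⟨l, hl, hlc, hle⟩

theorem luxNorm_le {P : ℝ → ℝ} {l : ℝ} (hl : 0 < l)
    (h : ∫⁻ x, ENNReal.ofReal (P (|u x| / l)) ∂μ ≤ 1) : luxNorm P μ u ≤ ENNReal.ofReal l :=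
  sInf_le ⟨l, hl, rfl, h⟩

theorem lintegral_expLLog_anti {l m : ℝ} (hl : 0 < l) (hlm : l ≤ m) :
    ∫⁻ x, ENNReal.ofReal (expLLog (|u x| / m)) ∂μ ≤
      ∫⁻ x, ENNReal.ofReal (expLLog (|u x| / l)) ∂μ := by
  have hm := hl.trans_le hlm
  refine lintegral_mono fun x => ENNReal.ofReal_le_ofReal (expLLog_mono (by positivity) ?_)
  gcongr

/-- Strictness avoids asking whether the infimum in the norm is attained; it is the reason for using
`β + ε` instead of `β`. -/
theorem lintegral_expLLog_le_one {c : ℝ} (h : luxNorm expLLog μ u < ENNReal.ofReal c) :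
    ∫⁻ x, ENNReal.ofReal (expLLog (|u x| / c)) ∂μ ≤ 1 := by
  obtain ⟨l, hl, hlc, hle⟩ := exists_of_luxNorm_lt h
  exact (lintegral_expLLog_anti hl ((ENNReal.ofReal_le_ofReal_iff'.1 hlc.le).resolve_right
    (not_le.2 hl))).trans hle

/-- Since the modular decreases in the parameter, each sublevel set of the norm is a union over
rational parameters, hence countable. -/
theorem measurable_luxNorm_expLLog [SFinite μ] {α : Type*} [MeasurableSpace α] {v : α → Ω → ℝ}
    (hv : Measurable (Function.uncurry v)) : Measurable fun a => luxNorm expLLog μ (v a) := by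
  refine measurable_of_Iio fun c => ?_
  have hm : ∀ q : ℝ, MeasurableSet
      {a | ∫⁻ x, ENNReal.ofReal (expLLog (|v a x| / q)) ∂μ ≤ 1} := by
    intro q
    have h1 : Measurable (Function.uncurry fun a x => ENNReal.ofReal (expLLog (|v a x| / q))) := by
      have h2 : Measurable fun p : α × Ω => |v p.1 p.2| := continuous_abs.measurable.comp hv
      exact (measurable_expLLog.comp (h2.div_const q)).ennreal_ofReal
    exact measurableSet_le h1.lintegral_prod_right' measurable_const
  have he : (fun a => luxNorm expLLog μ (v a)) ⁻¹' Iio c =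
      ⋃ q : {q : ℚ // 0 < q ∧ ENNReal.ofReal (q : ℝ) < c},
        {a | ∫⁻ x, ENNReal.ofReal (expLLog (|v a x| / (q.1 : ℝ))) ∂μ ≤ 1} := by
    ext a
    simp only [mem_preimage, mem_Iio, mem_iUnion, mem_ofPred_eq]
    constructor
    · intro h
      obtain ⟨l, hl, hlc, hle⟩ := exists_of_luxNorm_lt h
      obtain ⟨q, hlq, hqc⟩ : ∃ q : ℚ, l < q ∧ ENNReal.ofReal (q : ℝ) < c := by
        rcases eq_or_ne c ∞ with rfl | hc
        · obtain ⟨q, hq⟩ := exists_rat_gt l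
          exact ⟨q, hq, ENNReal.ofReal_lt_top⟩
        · obtain ⟨q, hq1, hq2⟩ := exists_rat_btwn ((ENNReal.ofReal_lt_iff_lt_toReal hl.le hc).1 hlc)
          exact ⟨q, hq1, (ENNReal.ofReal_lt_iff_lt_toReal (hl.le.trans hq1.le) hc).2 hq2⟩
      exact ⟨⟨q, by exact_mod_cast hl.trans hlq, hqc⟩, (lintegral_expLLog_anti hl hlq.le).trans hle⟩
    · rintro ⟨⟨q, hq, hqc⟩, hle⟩
      exact (luxNorm_le (by exact_mod_cast hq) hle).trans_lt hqc
  rw [he]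
  exact MeasurableSet.iUnion fun q => hm _

/-- For `l ≥ 1`, dividing `u` by `l` divides the modular by at least `l`, because the exponential
factor is nondecreasing. -/
theorem luxNorm_PhiFun_lt_top {α : ℝ} (hα : 0 < α) (hu : ∀ x, 0 ≤ u x)
    (h : ∫⁻ x, ENNReal.ofReal (PhiFun α (u x)) ∂μ < ∞) : luxNorm (PhiFun α) μ u < ∞ := by
  set I := ∫⁻ x, ENNReal.ofReal (PhiFun α (u x)) ∂μ with hI
  set l : ℝ := max 1 I.toReal with hl
  have hl1 : 1 ≤ l := le_max_left _ _
  have hl0 : 0 < l := zero_lt_one.trans_le hl1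
  refine (luxNorm_le hl0 ?_).trans_lt ENNReal.ofReal_lt_top
  have hpt : ∀ x, ENNReal.ofReal (PhiFun α (|u x| / l)) ≤
      ENNReal.ofReal (1 / l) * ENNReal.ofReal (PhiFun α (u x)) := by
    intro x
    rw [← ENNReal.ofReal_mul (by positivity), abs_of_nonneg (hu x)]
    refine ENNReal.ofReal_le_ofReal ?_
    have h0 : 0 ≤ u x / l := div_nonneg (hu x) hl0.le
    have h1 : logPlus (u x / l) ≤ logPlus (u x) := logPlus_mono h0 (div_le_self (hu x) hl1)
    have h2 := Real.rpow_le_rpow (zero_le_one.trans (one_le_logPlus _)) h1 hα.le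
    calc PhiFun α (u x / l) ≤ u x / l * Real.exp (logPlus (u x) ^ α) := by
          unfold PhiFun; gcongr
      _ = _ := by unfold PhiFun; ring
  refine (lintegral_mono hpt).trans ?_
  rw [lintegral_const_mul' _ _ ENNReal.ofReal_ne_top, ← hI, ← ENNReal.ofReal_toReal h.ne,
    ← ENNReal.ofReal_mul (by positivity), ENNReal.ofReal_le_one, one_div, inv_mul_le_iff₀ hl0,
    mul_one]
  exact le_max_right _ _

end LuxNorm

/-! ### Reduction to regular fields -/

section Reduction

variable {n : ℕ} {T : ℝ} {b : ℝ → E n → E n}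

theorem continuous_logPlus_norm : Continuous fun x : E n => logPlus ‖x‖ := by
  have h : ∀ x : E n, logPlus ‖x‖ = Real.log (max (Real.exp 1) ‖x‖) := by
    intro x
    rw [logPlus]
    rcases le_total (Real.exp 1) ‖x‖ with h | h
    · rw [max_eq_right h, max_eq_right
        ((Real.le_log_iff_exp_le ((Real.exp_pos 1).trans_le h)).2 h)]
    · rw [max_eq_left h, Real.log_exp]
      refine max_eq_left ?_
      rcases (norm_nonneg x).eq_or_lt with h0 | h0
      · rw [← h0]; simp
      · exact (Real.log_le_iff_le_exp h0).2 h
  simp only [h]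
  exact (continuous_const.max continuous_norm).log fun x =>
    (lt_max_of_lt_left (Real.exp_pos 1)).ne'

theorem IsSol.congr_ae {f f' : ℝ → E n → E n} {s T : ℝ} {x : E n} {y : ℝ → E n}
    (h : ∀ᵐ r ∂(volume.restrict (Icc s T)), f r = f' r) (hy : IsSol f s T x y) :
    IsSol f' s T x y := by
  have h' : (fun r => f r (y r)) =ᵐ[volume.restrict (Icc s T)] fun r => f' r (y r) :=
    h.mono fun r hr => by simp only [hr]
  refine ⟨hy.1.congr h', fun t ht => ?_⟩
  rw [hy.2 t ht]
  congr 1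
  rw [intervalIntegral.integral_of_le ht.1, intervalIntegral.integral_of_le ht.1]
  exact integral_congr_ae (ae_mono (Measure.restrict_mono
    (Ioc_subset_Icc_self.trans (Icc_subset_Icc_right ht.2)) le_rfl) h')

theorem enorm_le_eLpNorm_top_of_continuous {h : E n → ℝ} (hc : Continuous h) (x : E n) :
    ‖h x‖ₑ ≤ eLpNorm h ∞ volume := by
  have hcl : IsClosed {y | ‖h y‖ₑ ≤ eLpNorm h ∞ volume} :=
    isClosed_le hc.enorm continuous_const
  have hd : Dense {y | ‖h y‖ₑ ≤ eLpNorm h ∞ volume} := by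
    refine Measure.dense_of_ae (μ := volume) ?_
    rw [eLpNorm_exponent_top]
    exact enorm_ae_le_eLpNormEssSup h volume
  have : x ∈ closure {y | ‖h y‖ₑ ≤ eLpNorm h ∞ volume} := hd x
  rwa [hcl.closure_eq] at this

/-- An admissible field agrees, at almost all times in `[0, T]`, with a regular one. -/
theorem Admissible.exists_regularField (hb : Admissible T b) :
    ∃ f : ℝ → E n → E n, RegularField f ∧ ∀ᵐ t ∂(volume.restrict (Icc 0 T)), f t = b t := by
  set h : ℝ → E n → ℝ := fun t x => ‖b t x‖ / (1 + ‖x‖ * logPlus ‖x‖) with hh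
  have hden : ∀ x : E n, 0 < 1 + ‖x‖ * logPlus ‖x‖ := fun x => by
    have := zero_le_one.trans (one_le_logPlus ‖x‖)
    positivity
  have hhc : ∀ t ∈ Icc 0 T, Continuous (h t) := fun t ht =>
    (hb.contDiff t ht).continuous.norm.div
      (continuous_const.add (continuous_norm.mul continuous_logPlus_norm)) fun x => (hden x).ne'
  -- By continuity in `x`, a supremum over a dense sequence controls all `x`, and it is visibly
  -- measurable in `t`.
  set G : ℝ → ℝ≥0∞ := fun t => ⨆ k : ℕ, ENNReal.ofReal (h t (TopologicalSpace.denseSeq (E n) k))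
    with hG
  have hGm : Measurable G := by
    refine Measurable.iSup fun k => Measurable.ennreal_ofReal ?_
    exact ((hb.measurable.comp (measurable_id.prodMk measurable_const)).norm).div_const _
  have hh0 : ∀ t x, 0 ≤ h t x := fun t x => div_nonneg (norm_nonneg _) (hden x).le
  have hGle : ∀ t ∈ Icc 0 T, G t ≤ eLpNorm (h t) ∞ volume := fun t ht =>
    iSup_le fun k => by
      rw [← Real.enorm_eq_ofReal (hh0 _ _)]
      exact enorm_le_eLpNorm_top_of_continuous (hhc t ht) _
  have hGfin : ∫⁻ t in Icc 0 T, G t < ∞ :=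
    (setLIntegral_mono' measurableSet_Icc hGle).trans_lt hb.growth
  set S : Set ℝ := Icc 0 T ∩ {t | G t < ∞} with hS
  have hSm : MeasurableSet S :=
    measurableSet_Icc.inter (measurableSet_lt hGm measurable_const)
  have hSae : ∀ᵐ t ∂(volume.restrict (Icc 0 T)), t ∈ S := by
    filter_upwards [ae_lt_top hGm hGfin.ne, ae_restrict_mem measurableSet_Icc] with t h1 h2
    exact ⟨h2, h1⟩
  have hgrow : ∀ t ∈ S, ∀ x, ‖b t x‖ ≤ (G t).toReal * (1 + ‖x‖ * logPlus ‖x‖) := by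
    intro t ht x
    rw [← div_le_iff₀ (hden x)]
    have hcl : IsClosed {x | h t x ≤ (G t).toReal} := isClosed_le (hhc t ht.1) continuous_const
    have hsub : range (TopologicalSpace.denseSeq (E n)) ⊆ {x | h t x ≤ (G t).toReal} := by
      rintro _ ⟨k, rfl⟩
      refine (ENNReal.ofReal_le_iff_le_toReal ht.2.ne).1 ?_
      exact le_iSup (fun k => ENNReal.ofReal (h t (TopologicalSpace.denseSeq (E n) k))) k
    exact closure_minimal hsub hcl (TopologicalSpace.denseRange_denseSeq (E n) x)
  -- The field is set to zero at the null set of times in `[0, T]` where the growth rate is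
  -- infinite, and outside `[0, T]`.
  refine ⟨S.indicator b, ⟨?_, fun t => ?_, fun R => ?_, ?_⟩, ?_⟩
  · have : Function.uncurry (S.indicator b) =
        (Prod.fst ⁻¹' S).indicator fun p : ℝ × E n => b p.1 p.2 := by
      ext1 ⟨t, x⟩
      by_cases ht : t ∈ S <;> simp [Function.uncurry, ht]
    rw [this]
    exact hb.measurable.indicator (measurable_fst hSm)
  · by_cases ht : t ∈ S
    · rw [indicator_of_mem ht]
      exact (hb.contDiff t ht.1).of_le one_le_two
    · rw [indicator_of_notMem ht]
      exact contDiff_const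
  · obtain ⟨ℓ, hℓ, hℓb⟩ := hb.locLipschitz R
    refine ⟨(Icc 0 T).indicator fun t => |ℓ t|, (integrable_indicator_iff measurableSet_Icc).2
      hℓ.abs, fun t => indicator_nonneg (fun _ _ => abs_nonneg _) t, fun t x hx => ?_⟩
    by_cases ht : t ∈ S
    · rw [indicator_of_mem ht, indicator_of_mem ht.1]
      exact (hℓb t ht.1 x hx).trans (le_abs_self _)
    · rw [indicator_of_notMem ht]
      have : fderiv ℝ (0 : E n → E n) x = 0 := by simp
      rw [this, norm_zero]
      exact indicator_nonneg (fun _ _ => abs_nonneg _) t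
  · refine ⟨(Icc 0 T).indicator fun t => (G t).toReal, (integrable_indicator_iff
      measurableSet_Icc).2 (integrable_toReal_of_lintegral_ne_top hGm.aemeasurable hGfin.ne),
      fun t => indicator_nonneg (fun _ _ => ENNReal.toReal_nonneg) t, fun t x => ?_⟩
    by_cases ht : t ∈ S
    · rw [indicator_of_mem ht, indicator_of_mem ht.1]
      exact hgrow t ht x
    · rw [indicator_of_notMem ht]
      simp only [Pi.zero_apply, norm_zero]
      exact mul_nonneg (indicator_nonneg (fun _ _ => ENNReal.toReal_nonneg) t) (hden x).le
  · filter_upwards [hSae] with t ht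
    rw [indicator_of_mem ht]

end Reduction

/-! ### The bound for the density -/

section Bound

variable {n : ℕ}

/-- The bound for `∫ Φ_α (K_{s,t}) dμ`, in terms of the divergence `D` alone. -/
noncomputable def densityBound (n : ℕ) (T s t : ℝ) (D : Icc (0 : ℝ) T → E n → ℝ) : ℝ≥0∞ :=
  ENNReal.ofReal (Real.exp 1) * gauss n univ +
    ENNReal.ofReal youngConst * (1 + gauss n univ) *
      (ENNReal.ofReal T + ∫⁻ r in Icc s t,
        if h : r ∈ Icc 0 T then luxNorm expLLog (gauss n) (D ⟨r, h⟩) else 0)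

theorem densityBound_eq {T s t : ℝ} (hs : 0 ≤ s) (ht : t ≤ T) (b : ℝ → E n → E n) :
    densityBound n T s t (fun r : Icc (0 : ℝ) T => divGauss (b r)) =
      ENNReal.ofReal (Real.exp 1) * gauss n univ +
        ENNReal.ofReal youngConst * (1 + gauss n univ) *
          (ENNReal.ofReal T + ∫⁻ r in Icc s t, beta b r) := by
  unfold densityBound
  congr 3
  refine setLIntegral_congr_fun measurableSet_Icc fun r hr => ?_
  simp only
  rw [dif_pos (Icc_subset_Icc hs ht hr), beta]

theorem RegularField.lintegral_PhiFun_density_le {f : ℝ → E n → E n} (hf : RegularField f)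
    {X : ℝ → ℝ → E n → E n} (hXm : Measurable (fun p : ℝ × ℝ × E n => X p.1 p.2.1 p.2.2))
    {T s t : ℝ} (hs : 0 ≤ s) (hst : s ≤ t) (ht : t ≤ T)
    (hX : ∀ x, IsSol f s t x (fun r => X s r x)) (hβ : ∫⁻ r in Icc s t, beta f r < ∞)
    {α : ℝ} (hα : 0 < α) (hα' : α < Real.exp (-16 * (∫⁻ r in Icc s t, beta f r).toReal)) :
    ∫⁻ x, ENNReal.ofReal (PhiFun α (density X s t x)) ∂(gauss n) ≤
      densityBound n T s t (fun r : Icc (0 : ℝ) T => divGauss (f r)) := by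
  have hβm : Measurable (beta f) := measurable_luxNorm_expLLog
    (measurable_divGauss hf.measurable fun t => (hf.contDiff t).differentiable one_ne_zero)
  set Q := (∫⁻ r in Icc s t, beta f r).toReal with hQ
  -- The strict bound on `α` leaves room for `B = β + ε`, which is positive and, where `β` is
  -- finite, strictly above `β`. Taking `ε ≤ 1` makes the extra term at most `T`, so that the final
  -- bound does not involve `ε`.
  obtain ⟨ε, hε0, hε1, hε⟩ : ∃ ε : ℝ, 0 < ε ∧ ε ≤ 1 ∧ α ≤ Real.exp (-16 * (Q + ε * (t - s))) := by
    have hc : ContinuousAt (fun ε : ℝ => Real.exp (-16 * (Q + ε * (t - s)))) 0 := by fun_prop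
    have h1 : ∀ᶠ ε in 𝓝[>] (0 : ℝ), α < Real.exp (-16 * (Q + ε * (t - s))) :=
      nhdsWithin_le_nhds (hc.eventually_const_lt (by simpa using hα'))
    have h2 : ∀ᶠ ε in 𝓝[>] (0 : ℝ), ε ≤ 1 :=
      nhdsWithin_le_nhds (eventually_le_nhds zero_lt_one)
    have h3 : ∀ᶠ ε in 𝓝[>] (0 : ℝ), 0 < ε := self_mem_nhdsWithin
    obtain ⟨ε, h3, h4, h5⟩ := (h1.and (h2.and h3)).exists
    exact ⟨ε, h5, h4, h3.le⟩
  set B : ℝ → ℝ := fun r => (beta f r).toReal + ε with hB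
  have hBm : Measurable B := hβm.ennreal_toReal.add_const ε
  have hB0 : ∀ r, 0 < B r := fun r => by
    have : 0 ≤ (beta f r).toReal := ENNReal.toReal_nonneg
    positivity
  have hβi : IntegrableOn (fun r => (beta f r).toReal) (Icc s t) :=
    integrable_toReal_of_lintegral_ne_top hβm.aemeasurable hβ.ne
  have hci : IntegrableOn (fun _ : ℝ => ε) (Icc s t) := by simp
  have hfin : ∀ᵐ r ∂(volume.restrict (Icc s t)), beta f r < ∞ := ae_lt_top hβm hβ.ne
  have hint : ∫ r in s..t, B r = Q + ε * (t - s) := by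
    rw [intervalIntegral.integral_of_le hst, ← integral_Icc_eq_integral_Ioc,
      integral_add hβi hci, integral_toReal hβm.aemeasurable hfin, setIntegral_const, hQ]
    simp [hst, mul_comm]
  have hmain := hf.lintegral_expPotential_le hXm hst hX hBm hB0 (hβi.add hci) (by
    filter_upwards [hfin] with r hr
    refine lintegral_expLLog_le_one ?_
    change beta f r < _
    rw [ENNReal.lt_ofReal_iff_toReal_lt hr.ne]
    exact lt_add_of_pos_right (a := (beta f r).toReal) hε0)
  have hφm : Measurable fun k : ℝ => Real.exp (logPlus k ^ α) :=
    (measurable_logPlus.pow_const α).exp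
  have hBle : ∫⁻ r in Icc s t, ENNReal.ofReal (B r) ≤
      ENNReal.ofReal T + ∫⁻ r in Icc s t, beta f r := by
    calc ∫⁻ r in Icc s t, ENNReal.ofReal (B r)
        ≤ ∫⁻ r in Icc s t, (1 + beta f r) := by
          refine lintegral_mono fun r => ?_
          rw [add_comm 1, hB]
          refine ENNReal.ofReal_add_le.trans (add_le_add ENNReal.ofReal_toReal_le ?_)
          exact ENNReal.ofReal_le_one.2 hε1
      _ = ENNReal.ofReal (t - s) + ∫⁻ r in Icc s t, beta f r := by
          rw [lintegral_add_left measurable_const]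
          simp
      _ ≤ _ := by
          gcongr
          linarith
  calc ∫⁻ x, ENNReal.ofReal (PhiFun α (density X s t x)) ∂(gauss n)
      = ∫⁻ x, ENNReal.ofReal (Real.exp (logPlus (Real.exp (-divIntegral f X s t x)) ^ α))
          ∂(gauss n) := hf.lintegral_density hXm hst hX hφm
    _ ≤ ∫⁻ x, ENNReal.ofReal (expPotential (divIntegral f X s t x, ∫ r in s..t, B r))
          ∂(gauss n) := by
        refine lintegral_mono fun x => ENNReal.ofReal_le_ofReal ?_
        exact exp_logPlus_rpow_le hα (by rw [hint]; exact hε)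
    _ ≤ _ := hmain
    _ ≤ _ := by
        rw [densityBound_eq hs ht]
        gcongr

end Bound

end SubexpFlow

/-! ### The main theorem. -/

theorem theorem1p2 (n : ℕ) (T : ℝ) (hT : 0 < T) :
    ∃ C : ℝ → ℝ → ℝ → (Icc (0 : ℝ) T → SubexpFlow.E n → ℝ) → ℝ≥0,
      ∀ b : ℝ → SubexpFlow.E n → SubexpFlow.E n, SubexpFlow.Admissible T b →
        ∃ X : ℝ → ℝ → SubexpFlow.E n → SubexpFlow.E n,
          Measurable (fun p : ℝ × ℝ × SubexpFlow.E n => X p.1 p.2.1 p.2.2) ∧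
          SubexpFlow.IsFlow T b X ∧
          (∀ Y : ℝ → ℝ → SubexpFlow.E n → SubexpFlow.E n, SubexpFlow.IsFlow T b Y →
            ∀ s t : ℝ, 0 ≤ s → s ≤ t → t ≤ T → ∀ x, Y s t x = X s t x) ∧
          ∀ s t : ℝ, 0 ≤ s → s ≤ t → t ≤ T →
            (SubexpFlow.gauss n).map (X s t) ≪ SubexpFlow.gauss n ∧
            ∀ α : ℝ, 0 < α →
              α < Real.exp (-16 * Real.exp 1 *
                (∫⁻ r in Icc s t, SubexpFlow.beta b r).toReal) →
              SubexpFlow.MemOrlicz (SubexpFlow.PhiFun α) (SubexpFlow.gauss n)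
                (SubexpFlow.density X s t) ∧
              ∫⁻ x, ENNReal.ofReal (SubexpFlow.PhiFun α (SubexpFlow.density X s t x))
                  ∂(SubexpFlow.gauss n) ≤
                C α s t (fun r : Icc (0 : ℝ) T => SubexpFlow.divGauss (b r)) := by
  -- The constant does not depend on `α`. `toNNReal` loses nothing for the divergence of an
  -- admissible field, where `densityBound` is finite.
  refine ⟨fun _ s t D => (SubexpFlow.densityBound n T s t D).toNNReal, fun b hb => ?_⟩
  obtain ⟨f, hf, hfb⟩ := hb.exists_regularField
  obtain ⟨X, hXm, hX⟩ := hf.exists_flow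
  have hae : ∀ {s t : ℝ}, 0 ≤ s → t ≤ T → ∀ᵐ r ∂(volume.restrict (Icc s t)), f r = b r :=
    fun hs ht => ae_mono (Measure.restrict_mono (Icc_subset_Icc hs ht) le_rfl) hfb
  refine ⟨X, hXm, fun s hs x => (hX s T hs.2 x).congr_ae (hae hs.1 le_rfl), ?_, ?_⟩
  · intro Y hY s t hs hst ht x
    have hYs : SubexpFlow.IsSol b s T x fun r => Y s r x := hY s ⟨hs, hst.trans ht⟩ x
    exact hf.eq_of_isSol ((hYs.mono ht).congr_ae ((hae hs ht).mono fun _ h => h.symm))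
      (hX s t hst x) hst
  · intro s t hs hst ht
    refine ⟨(hf.density_flow hXm hst (hX s t hst)).1, fun α hα hα' => ?_⟩
    have hβ : ∫⁻ r in Icc s t, SubexpFlow.beta f r = ∫⁻ r in Icc s t, SubexpFlow.beta b r :=
      lintegral_congr_ae ((hae hs ht).mono fun r hr => by simp only [SubexpFlow.beta, hr])
    have hβb : ∫⁻ r in Icc s t, SubexpFlow.beta b r < ∞ :=
      (lintegral_mono_set (Icc_subset_Icc hs ht)).trans_lt hb.divergence
    have hfin : SubexpFlow.densityBound n T s t
        (fun r : Icc (0 : ℝ) T => SubexpFlow.divGauss (b r)) ≠ ∞ := by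
      rw [SubexpFlow.densityBound_eq hs ht]
      have h1 := measure_ne_top (SubexpFlow.gauss n) univ
      finiteness
    have hle : ∫⁻ x, ENNReal.ofReal (SubexpFlow.PhiFun α (SubexpFlow.density X s t x))
        ∂(SubexpFlow.gauss n) ≤ SubexpFlow.densityBound n T s t
          (fun r : Icc (0 : ℝ) T => SubexpFlow.divGauss (b r)) := by
      have h := hf.lintegral_PhiFun_density_le hXm hs hst ht (hX s t hst) (hβ ▸ hβb) hα (by
        rw [hβ]
        -- The argument works with the rate `16`; the smaller range of `α` with `16e` is contained
        -- in it.
        refine hα'.trans_le (Real.exp_le_exp.2 ?_)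
        have h1 : 1 ≤ Real.exp 1 := Real.one_le_exp zero_le_one
        have h2 : 0 ≤ (∫⁻ r in Icc s t, SubexpFlow.beta b r).toReal := ENNReal.toReal_nonneg
        nlinarith [mul_le_mul_of_nonneg_right h1 h2])
      rwa [SubexpFlow.densityBound_eq hs ht, hβ, ← SubexpFlow.densityBound_eq hs ht] at h
    refine ⟨⟨(Measure.measurable_rnDeriv _ _).ennreal_toReal.aestronglyMeasurable, ?_⟩, ?_⟩
    · exact SubexpFlow.luxNorm_PhiFun_lt_top hα (fun _ => ENNReal.toReal_nonneg)
        (hle.trans_lt hfin.lt_top)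
    · rwa [ENNReal.coe_toNNReal hfin]
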